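/- Let $k\in\mathbb{C}$, let $m\ge n\ge 0$ be integers, and put $\alpha_1=k+n$, $\alpha_2=k+m$. For $1\le i\le m+n$ let $\mathrm{col}(i)=1$, $\mathrm{row}(i)=i$ if $i\le m$, and $\mathrm{col}(i)=2$, $\mathrm{row}(i)=i-n$ if $i>m$; for $m-n<i\le m$ put $\hat i=i+n$, and for $j>m$ put $\tilde j=j-n$. Let $f=\sum_{m<j\le m+n}e_{j,j-n}\in\mathfrak{gl}(m+n)$, a nilpotent element of Jordan type $(2^n,1^{m-n})$. Let $\mathfrak b=\bigoplus_{\mathrm{col}(i)\ge\mathrm{col}(j)}\mathbb{C}e_{i,j}\subset\mathfrak{gl}(m+n)$ with the form $\kappa(e_{i,j},e_{p,q})=\alpha_c\delta_{i,q}\delta_{p,j}+\delta_{i,j}\delta_{p,q}$ if $i,j,p,q$ all lie in column $c$, and $\kappa(e_{i,j},e_{p,q})=0$ otherwise. Let $\mathfrak a=\mathfrak b\oplus\bigoplus_{\mathrm{col}(i)>\mathrm{col}(j)}\mathbb{C}\psi_{i,j}$ be the Lie superalgebra with $\psi_{i,j}$ odd, $[e_{i,j},\psi_{p,q}]=\delta_{j,p}\psi_{i,q}-\delta_{i,q}\psi_{p,j}$,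 $[\psi_{i,j},\psi_{p,q}]=0$, and let $\tilde\kappa$ be the extension of $\kappa$ by zero. Let $V^\kappa(\mathfrak b)$ and $V^{\tilde\kappa}(\mathfrak a)$ be the universal affine vertex (super)algebras, write $x[-r]=xt^{-r}$, and read products of such elements as $(-1)$-products. The $W$-algebra is the vertex subalgebra $$\mathcal{W}^k(\mathfrak{gl}(m+n),f)=\{y\in V^\kappa(\mathfrak b)\mid d_0(y)=0\},$$ where $d_0\colon V^\kappa(\mathfrak b)\to V^{\tilde\kappa}(\mathfrak a)$ is the odd differential (a derivation of all $n$-th products) determined by $d_0|0\rangle=0$, $[d_0,\partial]=0$ and $$d_0(e_{i,j}[-1])=\sum_{\mathrm{col}(i)>\mathrm{col}(r)\ge\mathrm{col}(j)}e_{r,j}[-1]\psi_{i,r}[-1]-\sum_{\mathrm{col}(j)<\mathrm{col}(r)\le\mathrm{col}(i)}\psi_{r,j}[-1]e_{i,r}[-1]+\delta(\mathrm{col}(i)>\mathrm{col}(j))\,\alpha_2\psi_{i,j}[-2]+\psi_{\hat i,j}[-1]-\psi_{i,\tilde j}[-1],$$ terms whose index $\hat i$ or $\tilde j$ does not exist being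 $0$. It is graded by conformal weight, where $e_{i,j}[-1]$ has weight $1+\mathrm{col}(i)-\mathrm{col}(j)$. Define the following elements of it: $$W^{(1)}_{i,j}=\sum_{\substack{\mathrm{row}(h)=i,\ \mathrm{row}(l)=j\\ \mathrm{col}(h)=\mathrm{col}(l)}}e_{h,l}[-1]\qquad(1\le i\le m-n,\ 1\le j\le m,\ \text{ or }\ m-n<i,j\le m),$$ $$W^{(2)}_{i,j}=e_{\hat i,j}[-1]-\alpha_2e_{i,j}[-2]+\sum_{m-n<u\le m}e_{u,j}[-1]e_{\hat i,\hat u}[-1]-\sum_{1\le u\le m-n}e_{u,j}[-1]e_{i,u}[-1]\qquad(m-n<i\le m,\ 1\le j\le m).$$ For a graded vertex algebra $V$ let $L(V)=V\otimes\mathbb{C}[t,t^{-1}]/\mathrm{Im}(\partial\otimes\mathrm{id}+\mathrm{id}\otimes\frac{d}{dt})$ be its Borcherds Lie algebra, with $[ut^a,vt^b]=\sum_{r\ge0}\binom{a}{r}(u_{(r)}v)t^{a+b-r}$, and let $\mathcal{U}(V)$ be the quotient of the degreewise completion of $U(L(V))$ (with $\deg(ut^a)=a-\Delta+1$ for $u$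 of weight $\Delta$, the degree $d$ part being $\varprojlim_N U(L(V))_d/\sum_{r>N}U(L(V))_{d-r}U(L(V))_r$) by the completion of the two-sided ideal generated by $|0\rangle t^{-1}-1$ and all $$(u_{(a)}v)t^b-\sum_{i\ge0}\binom{a}{i}(-1)^i\bigl(ut^{a-i}\,vt^{b+i}-(-1)^a\,vt^{a+b-i}\,ut^{i}\bigr),\qquad u,v\in V,\ a,b\in\mathbb{Z}.$$ Then for all $i,j,p,q\in\{m-n+1,\dots,m\}$ and all $s,u\in\mathbb{Z}$ the following identity holds in $\mathcal{U}(\mathcal{W}^k(\mathfrak{gl}(m+n),f))$: $$\begin{aligned} [W^{(1)}_{p,q}t^s,W^{(2)}_{i,j}t^u]={}&-\delta_{p,j}W^{(2)}_{i,q}t^{s+u}+\delta_{i,q}W^{(2)}_{p,j}t^{s+u}\\ &+\delta_{p,j}\,s\,\alpha_1W^{(1)}_{i,q}t^{s+u-1}+\delta_{p,q}\,s\,W^{(1)}_{i,j}t^{s+u-1}+\delta_{p,j}\delta_{q,i}\,s\sum_{1\le w\le m-n}W^{(1)}_{w,w}t^{s+u-1}\\ &-\delta_{q,i}\delta_{p,j}\delta_{s+u,1}\frac{s(s-1)}{2}(\alpha_1+\alpha_2)\alpha_1-\delta_{p,q}\delta_{i,j}\delta_{s+u,1}\,s(s-1)\,\alpha_2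 . \end{aligned}$$ -/

import Mathlib

/-! ### Affine vertex (super)algebras: state space and fields -/

/-- A Lie superalgebra over `ℂ` with a homogeneous basis `ι`,
given by parities, structure constants and an invariant form on basis vectors. -/
structure AffineData (ι : Type) where
  parity : ι → ℕ
  bracket : ι → ι → (ι →₀ ℂ)
  form : ι → ι → ℂ

namespace AffineData

variable {ι : Type} (D : AffineData ι)

/-- The (super)commutation relation
`x[r] y[s] = (-1)^{p(x)p(y)} y[s] x[r] + [x,y][r+s] + r δ_{r+s,0} (x|y)`. -/
inductive ModeRel : FreeAlgebra ℂ (ι × ℤ) → FreeAlgebra ℂ (ι × ℤ) → Prop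
  | comm (x y : ι) (r s : ℤ) :
      ModeRel (FreeAlgebra.ι ℂ (x, r) * FreeAlgebra.ι ℂ (y, s))
        ((-1 : ℂ) ^ (D.parity x * D.parity y) •
            (FreeAlgebra.ι ℂ (y, s) * FreeAlgebra.ι ℂ (x, r))
          + (D.bracket x y).sum (fun z c => c • FreeAlgebra.ι ℂ (z, r + s))
          + algebraMap ℂ (FreeAlgebra ℂ (ι × ℤ))
              (if r + s = 0 then (r : ℂ) * D.form x y else 0))

/-- The universal enveloping algebra of the affinization, with central element set to `1`. -/
def Modes : Type := RingQuot D.ModeRel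

noncomputable instance : Ring D.Modes := inferInstanceAs (Ring (RingQuot D.ModeRel))
noncomputable instance : Algebra ℂ D.Modes := inferInstanceAs (Algebra ℂ (RingQuot D.ModeRel))

/-- The quotient map. -/
noncomputable def toModes : FreeAlgebra ℂ (ι × ℤ) →ₐ[ℂ] D.Modes :=
  RingQuot.mkAlgHom ℂ D.ModeRel

/-- The mode `x[r] = x t^r` of a basis vector. -/
noncomputable def gen (x : ι) (r : ℤ) : D.Modes := D.toModes (FreeAlgebra.ι ℂ (x, r))

/-- The mode `x[r] = x t^r` of an arbitrary vector. -/
noncomputable def mode (x : ι →₀ ℂ) (r : ℤ) : D.Modes :=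
  x.sum fun z c => c • D.gen z r

theorem gen_comm (x y : ι) (r s : ℤ) :
    D.gen x r * D.gen y s = (-1 : ℂ) ^ (D.parity x * D.parity y) • (D.gen y s * D.gen x r)
      + D.mode (D.bracket x y) (r + s)
      + algebraMap ℂ D.Modes (if r + s = 0 then (r : ℂ) * D.form x y else 0) := by
  have h : D.toModes _ = D.toModes _ := RingQuot.mkAlgHom_rel ℂ (ModeRel.comm (D := D) x y r s)
  rw [map_mul, map_add, map_add, map_smul, map_mul, AlgHom.commutes, map_finsuppSum] at h
  simp only [map_smul] at h
  exact h

/-- The left ideal generated by all `x[r]` with `r ≥ 0`. -/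
noncomputable def vacIdeal : Submodule D.Modes D.Modes :=
  Submodule.span D.Modes {z | ∃ (x : ι) (r : ℤ), 0 ≤ r ∧ z = D.gen x r}

/-- The state space of the universal affine vertex (super)algebra: the vacuum module. -/
def Vac : Type := D.Modes ⧸ D.vacIdeal

noncomputable instance : AddCommGroup D.Vac :=
  inferInstanceAs (AddCommGroup (D.Modes ⧸ D.vacIdeal))
noncomputable instance : Module D.Modes D.Vac :=
  inferInstanceAs (Module D.Modes (D.Modes ⧸ D.vacIdeal))
noncomputable instance : Module ℂ D.Vac :=
  inferInstanceAs (Module ℂ (D.Modes ⧸ D.vacIdeal))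
instance : IsScalarTower ℂ D.Modes D.Vac :=
  inferInstanceAs (IsScalarTower ℂ D.Modes (D.Modes ⧸ D.vacIdeal))

/-- The vacuum vector. -/
noncomputable def vac : D.Vac := (Submodule.Quotient.mk 1 : D.Modes ⧸ D.vacIdeal)

theorem gen_vac (x : ι) (r : ℤ) (hr : 0 ≤ r) : D.gen x r • D.vac = 0 := by
  have h : (Submodule.Quotient.mk (D.gen x r) : D.Modes ⧸ D.vacIdeal) = 0 :=
    (Submodule.Quotient.mk_eq_zero _).2 (Submodule.subset_span ⟨x, r, hr, rfl⟩)
  have h2 : D.gen x r • D.vac =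
      (Submodule.Quotient.mk (D.gen x r • (1 : D.Modes)) : D.Modes ⧸ D.vacIdeal) := rfl
  rw [h2, smul_eq_mul, mul_one]
  exact h

/-- The field `x(z) = ∑ x_{(r)} z^{-r-1}` of a vector, as its family of modes. -/
noncomputable def field (x : ι →₀ ℂ) : ℤ → D.Vac → D.Vac := fun r v => D.mode x r • v

end AffineData

/-- The `n`-th product `A_{(n)}B` of two fields (given by their modes), not both odd:
`(A_{(n)}B)_{(k)} = ∑_{i ≥ 0} (-1)^i (n choose i)
  (A_{(n-i)} B_{(k+i)} - (-1)^n B_{(n+k-i)} A_{(i)})`;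
the sum is finite on every vector. -/
noncomputable def fieldProd {V : Type} [AddCommGroup V] [Module ℂ V]
    (A : ℤ → V → V) (n : ℤ) (B : ℤ → V → V) : ℤ → V → V := fun k v =>
  ∑ᶠ i : ℕ, ((-1 : ℂ) ^ i * ((Ring.choose n i : ℤ) : ℂ)) •
    (A (n - i) (B (k + i) v) - ((-1 : ℂ) ^ n) • B (n + k - i) (A i v))

/-! ### The Lie superalgebras `𝔟` and `𝔞`

All indices are natural numbers counted from `1`. -/

/-- Column of an index. -/
def col (m i : ℕ) : ℕ := if i ≤ m then 1 else 2

/-- Row of an index. -/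
def row (m n i : ℕ) : ℕ := if i ≤ m then i else i - n

/-- Indices of the basis `e_{i,j}`, `col i ≥ col j`, of `𝔟`. -/
abbrev BIdx (m n : ℕ) : Type :=
  {x : ℕ × ℕ // (x.1 ∈ Finset.Icc 1 (m + n) ∧ x.2 ∈ Finset.Icc 1 (m + n)) ∧ col m x.2 ≤ col m x.1}

/-- Indices of the odd basis vectors `ψ_{i,j}`, `col i > col j`, of `𝔞`. -/
abbrev PsiIdx (m n : ℕ) : Type :=
  {x : ℕ × ℕ // (x.1 ∈ Finset.Icc 1 (m + n) ∧ x.2 ∈ Finset.Icc 1 (m + n)) ∧ col m x.2 < col m x.1}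

/-- `e_{i,j}` as an element of `𝔟`; it is `0` if `(i,j)` is not an index of `𝔟`. -/
noncomputable def eB (m n i j : ℕ) : BIdx m n →₀ ℂ :=
  if h : (i ∈ Finset.Icc 1 (m + n) ∧ j ∈ Finset.Icc 1 (m + n)) ∧ col m j ≤ col m i then
    Finsupp.single ⟨(i, j), h⟩ 1 else 0

/-- `e_{i,j}` as an element of `𝔞`. -/
noncomputable def eA (m n i j : ℕ) : BIdx m n ⊕ PsiIdx m n →₀ ℂ :=
  (eB m n i j).mapDomain Sum.inl

/-- `ψ_{i,j}` as an element of `𝔞`; it is `0` if `(i,j)` is not an index of an odd basis vector. -/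
noncomputable def psiA (m n i j : ℕ) : BIdx m n ⊕ PsiIdx m n →₀ ℂ :=
  if h : (i ∈ Finset.Icc 1 (m + n) ∧ j ∈ Finset.Icc 1 (m + n)) ∧ col m j < col m i then
    Finsupp.single (Sum.inr ⟨(i, j), h⟩) 1 else 0

/-- `α₁ = k + n`. -/
noncomputable def alpha1 (k : ℂ) (n : ℕ) : ℂ := k + n

/-- `α₂ = k + m`. -/
noncomputable def alpha2 (k : ℂ) (m : ℕ) : ℂ := k + m

/-- The form `κ(e_{i,j}, e_{p,q})`: it is `α_c δ_{i,q} δ_{p,j} + δ_{i,j} δ_{p,q}` when all four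
indices lie in column `c`, and `0` otherwise. -/
noncomputable def kappaForm (k : ℂ) (m n : ℕ) (i j p q : ℕ) : ℂ :=
  if i ≤ m ∧ j ≤ m ∧ p ≤ m ∧ q ≤ m then
    (if i = q ∧ p = j then alpha1 k n else 0) + (if i = j ∧ p = q then 1 else 0)
  else if m < i ∧ m < j ∧ m < p ∧ m < q then
    (if i = q ∧ p = j then alpha2 k m else 0) + (if i = j ∧ p = q then 1 else 0)
  else 0

/-- The Lie algebra `𝔟` (a subalgebra of `𝔤𝔩(m+n)`) with its form `κ`. -/
noncomputable def bData (k : ℂ) (m n : ℕ) : AffineData (BIdx m n) where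
  parity _ := 0
  bracket x y := (if x.1.2 = y.1.1 then eB m n x.1.1 y.1.2 else 0)
    - (if x.1.1 = y.1.2 then eB m n y.1.1 x.1.2 else 0)
  form x y := kappaForm k m n x.1.1 x.1.2 y.1.1 y.1.2

/-- The Lie superalgebra `𝔞 = 𝔟 ⊕ ⨁ ℂ ψ_{i,j}` with the form extending `κ` by zero. -/
noncomputable def aData (k : ℂ) (m n : ℕ) : AffineData (BIdx m n ⊕ PsiIdx m n) where
  parity
    | Sum.inl _ => 0
    | Sum.inr _ => 1
  bracket
    | Sum.inl x, Sum.inl y => ((bData k m n).bracket x y).mapDomain Sum.inl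
    | Sum.inl x, Sum.inr y => (if x.1.2 = y.1.1 then psiA m n x.1.1 y.1.2 else 0)
        - (if x.1.1 = y.1.2 then psiA m n y.1.1 x.1.2 else 0)
    | Sum.inr y, Sum.inl x => (if x.1.1 = y.1.2 then psiA m n y.1.1 x.1.2 else 0)
        - (if x.1.2 = y.1.1 then psiA m n x.1.1 y.1.2 else 0)
    | Sum.inr _, Sum.inr _ => 0
  form
    | Sum.inl x, Sum.inl y => (bData k m n).form x y
    | _, _ => 0

/-- State space of `V^κ(𝔟)`. -/
abbrev VB (k : ℂ) (m n : ℕ) : Type := (bData k m n).Vac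

/-- State space of `V^κ̃(𝔞)`. -/
abbrev VA (k : ℂ) (m n : ℕ) : Type := (aData k m n).Vac

/-- The algebra map of modes induced by `𝔟 ⊆ 𝔞`. -/
noncomputable def inclModes (k : ℂ) (m n : ℕ) : (bData k m n).Modes →ₐ[ℂ] (aData k m n).Modes :=
  RingQuot.liftAlgHom ℂ
    ⟨FreeAlgebra.lift ℂ fun z : BIdx m n × ℤ => (aData k m n).gen (Sum.inl z.1) z.2, by
      rintro _ _ ⟨x, y, r, s⟩
      rw [map_mul, map_add, map_add, map_smul, map_mul, AlgHom.commutes, map_finsuppSum]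
      simp only [map_smul, FreeAlgebra.lift_ι_apply]
      rw [AffineData.gen_comm]
      congr 2
      change (Finsupp.mapDomain Sum.inl ((bData k m n).bracket x y)).sum _ = _
      rw [Finsupp.sum_mapDomain_index (by simp) (by intros; rw [add_smul])]⟩

theorem inclModes_gen (k : ℂ) (m n : ℕ) (x : BIdx m n) (r : ℤ) :
    inclModes k m n ((bData k m n).gen x r) = (aData k m n).gen (Sum.inl x) r :=
  (RingQuot.liftAlgHom_mkAlgHom_apply ℂ _ _ _).trans (FreeAlgebra.lift_ι_apply _ _)

/-- The inclusion `V^κ(𝔟) → V^κ̃(𝔞)`, compatible with the modes of `𝔟` and the vacuum. -/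
noncomputable def incl (k : ℂ) (m n : ℕ) :
    VB k m n →ₛₗ[(inclModes k m n : (bData k m n).Modes →+* (aData k m n).Modes)] VA k m n :=
  Submodule.liftQ (bData k m n).vacIdeal
    { toFun := fun x => inclModes k m n x • (aData k m n).vac
      map_add' := fun x y => by rw [map_add, add_smul]
      map_smul' := fun c x => by rw [smul_eq_mul, map_mul, mul_smul]; rfl }
    (by
      unfold AffineData.vacIdeal
      rw [Submodule.span_le]
      rintro _ ⟨x, r, hr, rfl⟩
      change inclModes k m n ((bData k m n).gen x r) • (aData k m n).vac = 0
      rw [inclModes_gen, AffineData.gen_vac _ _ _ hr])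

theorem incl_vac (k : ℂ) (m n : ℕ) : incl k m n (bData k m n).vac = (aData k m n).vac := by
  change inclModes k m n 1 • (aData k m n).vac = _
  rw [map_one, one_smul]

theorem incl_gen (k : ℂ) (m n : ℕ) (x : BIdx m n) (r : ℤ) (v : VB k m n) :
    incl k m n ((bData k m n).gen x r • v)
      = (aData k m n).gen (Sum.inl x) r • incl k m n v := by
  rw [LinearMap.map_smulₛₗ]
  congr 1
  exact inclModes_gen k m n x r

/-! ### The differential `d₀` and the `W`-algebra -/

/-- The field `e_{i,j}(z)` on `V^κ̃(𝔞)`. -/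
noncomputable def eField (k : ℂ) (m n i j : ℕ) : ℤ → VA k m n → VA k m n :=
  (aData k m n).field (eA m n i j)

/-- The field `ψ_{i,j}(z)` on `V^κ̃(𝔞)`. -/
noncomputable def psiField (k : ℂ) (m n i j : ℕ) : ℤ → VA k m n → VA k m n :=
  (aData k m n).field (psiA m n i j)

/-- The field of the state `d₀(e_{i,j}[-1])`. The field of `ψ[-2]|0⟩` is the derivative of `ψ(z)`,
whose `s`-th mode is `-s ψ_{(s-1)}`. The terms containing `î` or `j̃` are absent when there is no
such index. -/
noncomputable def dField (k : ℂ) (m n i j : ℕ) : ℤ → VA k m n → VA k m n := fun s v =>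
  (∑ r ∈ (Finset.Icc 1 (m + n)).filter (fun r => col m r < col m i ∧ col m j ≤ col m r),
      fieldProd (eField k m n r j) (-1) (psiField k m n i r) s v)
  - (∑ r ∈ (Finset.Icc 1 (m + n)).filter (fun r => col m j < col m r ∧ col m r ≤ col m i),
      fieldProd (psiField k m n r j) (-1) (eField k m n i r) s v)
  + (if col m j < col m i then (alpha2 k m * (-(s : ℂ))) • psiField k m n i j (s - 1) v else 0)
  + (if m - n < i ∧ i ≤ m then psiField k m n (i + n) j s v else 0)
  - (if m < j then psiField k m n i (j - n) s v else 0)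

/-- `IsD0 v w` says `d₀ v = w`: the graph of the linear map `d₀ : V^κ(𝔟) → V^κ̃(𝔞)` determined by
`d₀|0⟩ = 0` and
`d₀(e_{i,j}[s] v) = (d₀ e_{i,j}[-1])_{(s)} v + e_{i,j}[s] d₀ v`. -/
inductive IsD0 (k : ℂ) (m n : ℕ) : VB k m n → VA k m n → Prop
  | vac : IsD0 k m n (bData k m n).vac 0
  | mode (x : BIdx m n) (s : ℤ) (v : VB k m n) (w : VA k m n) (h : IsD0 k m n v w) :
      IsD0 k m n ((bData k m n).gen x s • v)
        (dField k m n x.1.1 x.1.2 s (incl k m n v) + (aData k m n).gen (Sum.inl x) s • w)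
  | sum (v v' : VB k m n) (w w' : VA k m n) (h : IsD0 k m n v w) (h' : IsD0 k m n v' w') :
      IsD0 k m n (v + v') (w + w')
  | scal (c : ℂ) (v : VB k m n) (w : VA k m n) (h : IsD0 k m n v w) :
      IsD0 k m n (c • v) (c • w)

/-- The graph of `d₀` as a subspace. -/
noncomputable def d0Graph (k : ℂ) (m n : ℕ) : Submodule ℂ (VB k m n × VA k m n) where
  carrier := {p | IsD0 k m n p.1 p.2}
  add_mem' := fun h h' => IsD0.sum _ _ _ _ h h'
  zero_mem' := by
    have h := IsD0.scal 0 _ _ (IsD0.vac (k := k) (m := m) (n := n))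
    rwa [zero_smul, zero_smul] at h
  smul_mem' := fun c _ h => IsD0.scal c _ _ h

/-- The `W`-algebra `𝒲^k(𝔤𝔩(m+n), f) = {y ∈ V^κ(𝔟) | d₀ y = 0}`. -/
noncomputable def WAlg (k : ℂ) (m n : ℕ) : Submodule ℂ (VB k m n) :=
  (d0Graph k m n).comap (LinearMap.inl ℂ (VB k m n) (VA k m n))

theorem mem_WAlg (k : ℂ) (m n : ℕ) (v : VB k m n) : v ∈ WAlg k m n ↔ IsD0 k m n v 0 := Iff.rfl

/-- Homogeneous vectors of `V^κ(𝔟)`: `e_{i,j}[-1]|0⟩` has conformal weight `1 + col i - col j`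
and `e_{i,j}[s]` raises the weight by `col i - col j - s`. -/
inductive HasWeight (k : ℂ) (m n : ℕ) : ℤ → VB k m n → Prop
  | vac : HasWeight k m n 0 (bData k m n).vac
  | mode (x : BIdx m n) (s : ℤ) (Δ : ℤ) (v : VB k m n) (h : HasWeight k m n Δ v) :
      HasWeight k m n (Δ + ((col m x.1.1 : ℤ) - (col m x.1.2 : ℤ) - s))
        ((bData k m n).gen x s • v)

/-- The weight `Δ` subspace of `V^κ(𝔟)`. -/
noncomputable def weightSpace (k : ℂ) (m n : ℕ) (Δ : ℤ) : Submodule ℂ (VB k m n) :=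
  Submodule.span ℂ {v | HasWeight k m n Δ v}

/-- The weight `Δ` subspace of the `W`-algebra. -/
noncomputable def WGr (k : ℂ) (m n : ℕ) (Δ : ℤ) : Submodule ℂ (VB k m n) :=
  WAlg k m n ⊓ weightSpace k m n Δ

/-- The vacuum vector as an element of the `W`-algebra. -/
noncomputable def WVac (k : ℂ) (m n : ℕ) : WGr k m n 0 :=
  ⟨(bData k m n).vac, IsD0.vac, Submodule.subset_span HasWeight.vac⟩

/-- `IsStateField u A` says that `A` is the field `Y(u,z)` (given by its modes) of the state
`u ∈ V^κ(𝔟)`. The state-field correspondence is the linear map determined by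
`Y(|0⟩,z) = id` and `Y(x_{(r)} u, z) = x(z)_{(r)} Y(u,z)` for `x ∈ 𝔟`. -/
inductive IsStateField (k : ℂ) (m n : ℕ) : VB k m n → (ℤ → VB k m n → VB k m n) → Prop
  | vac : IsStateField k m n (bData k m n).vac (fun r v => if r = -1 then v else 0)
  | mode (x : BIdx m n) (r : ℤ) (u : VB k m n) (A : ℤ → VB k m n → VB k m n)
      (h : IsStateField k m n u A) :
      IsStateField k m n ((bData k m n).gen x r • u)
        (fieldProd (fun s v => (bData k m n).gen x s • v) r A)
  | sum (u u' : VB k m n) (A A' : ℤ → VB k m n → VB k m n) (h : IsStateField k m n u A)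
      (h' : IsStateField k m n u' A') : IsStateField k m n (u + u') (fun r v => A r v + A' r v)
  | scal (c : ℂ) (u : VB k m n) (A : ℤ → VB k m n → VB k m n) (h : IsStateField k m n u A) :
      IsStateField k m n (c • u) (fun r v => c • A r v)

/-- `NProd u r v w` says `u_{(r)} v = w` in the vertex algebra `V^κ(𝔟)`. -/
def NProd (k : ℂ) (m n : ℕ) (u : VB k m n) (r : ℤ) (v w : VB k m n) : Prop :=
  ∃ A, IsStateField k m n u A ∧ A r v = w

/-! ### The universal enveloping algebra of a graded vertex algebra

A graded vertex algebra enters through its weight spaces `gr Δ`, the graph `P u r v w` of its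
products `u_{(r)} v = w`, and its vacuum vector. -/

section Enveloping

variable {V : Type} [AddCommGroup V] [Module ℂ V] (gr : ℤ → Submodule ℂ V)
  (P : V → ℤ → V → V → Prop) (vac : gr 0)

/-- Generating symbols `u t^a`, `u` homogeneous of weight `Δ`. -/
abbrev LSym : Type := (Σ Δ : ℤ, gr Δ) × ℤ

/-- The symbol `u t^a` in the free algebra. -/
noncomputable def lsym {gr : ℤ → Submodule ℂ V} {Δ : ℤ} (u : gr Δ) (a : ℤ) :
    FreeAlgebra ℂ (LSym gr) :=
  FreeAlgebra.ι ℂ (⟨Δ, u⟩, a)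

/-- Defining relations of the universal enveloping algebra of the Borcherds Lie algebra
`L(V) = V ⊗ ℂ[t,t⁻¹] / im(∂ ⊗ 1 + 1 ⊗ d/dt)`: linearity in `u`, the relation
`(∂u) t^a = - a u t^{a-1}` where `∂u = u_{(-2)}|0⟩`, and
`[u t^a, v t^b] = ∑_{r ≥ 0} (a choose r) (u_{(r)} v) t^{a+b-r}`. -/
inductive LRel : FreeAlgebra ℂ (LSym gr) → FreeAlgebra ℂ (LSym gr) → Prop
  | sum {Δ : ℤ} (u v : gr Δ) (a : ℤ) : LRel (lsym (u + v) a) (lsym u a + lsym v a)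
  | scal {Δ : ℤ} (c : ℂ) (u : gr Δ) (a : ℤ) : LRel (lsym (c • u) a) (c • lsym u a)
  | deriv {Δ : ℤ} (u : gr Δ) (w : gr (Δ + 1)) (a : ℤ) (h : P u (-2) vac w) :
      LRel (lsym w a) ((-(a : ℂ)) • lsym u (a - 1))
  | comm {Δ Δ' : ℤ} (u : gr Δ) (v : gr Δ') (a b : ℤ) (w : (r : ℕ) → gr (Δ + Δ' - r - 1)) (N : ℕ)
      (h : ∀ r : ℕ, P u r v (w r)) (hN : ∀ r : ℕ, N ≤ r → w r = 0) :
      LRel (lsym u a * lsym v b)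
        (lsym v b * lsym u a
          + ∑ r ∈ Finset.range N, ((Ring.choose a r : ℤ) : ℂ) • lsym (w r) (a + b - r))

/-- The universal enveloping algebra `U(L(V))`. -/
def ULie : Type := RingQuot (LRel gr P vac)

noncomputable instance : Ring (ULie gr P vac) :=
  inferInstanceAs (Ring (RingQuot (LRel gr P vac)))
noncomputable instance : Algebra ℂ (ULie gr P vac) :=
  inferInstanceAs (Algebra ℂ (RingQuot (LRel gr P vac)))

/-- The quotient map. -/
noncomputable def toULie : FreeAlgebra ℂ (LSym gr) →ₐ[ℂ] ULie gr P vac :=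
  RingQuot.mkAlgHom ℂ (LRel gr P vac)

/-- The generator of `U(L(V))` given by a symbol. -/
noncomputable def ulie (x : LSym gr) : ULie gr P vac := toULie gr P vac (FreeAlgebra.ι ℂ x)

/-- The degree `a - Δ + 1` of `u t^a`. -/
def lsymDeg {gr : ℤ → Submodule ℂ V} (x : LSym gr) : ℤ := x.2 - x.1.1 + 1

/-- The degree `d` part of `U(L(V))`, spanned by the monomials of total degree `d`. -/
noncomputable def ULieDeg (d : ℤ) : Submodule ℂ (ULie gr P vac) :=
  Submodule.span ℂ {x | ∃ l : List (LSym gr),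
    (l.map lsymDeg).sum = d ∧ x = (l.map (ulie gr P vac)).prod}

/-- The left ideal `∑_{r > N} U(L(V)) U(L(V))_r`; its degree `d` part is
`∑_{r > N} U(L(V))_{d-r} U(L(V))_r`. -/
noncomputable def ULieNbhd (N : ℕ) : Submodule (ULie gr P vac) (ULie gr P vac) :=
  Submodule.span (ULie gr P vac) {x | ∃ r : ℤ, (N : ℤ) < r ∧ x ∈ ULieDeg gr P vac r}

theorem ULieNbhd_anti {M N : ℕ} (h : M ≤ N) : ULieNbhd gr P vac N ≤ ULieNbhd gr P vac M := by
  refine Submodule.span_mono ?_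
  rintro x ⟨r, hr, hx⟩
  exact ⟨r, by omega, hx⟩

theorem ulie_mem_deg (x : LSym gr) : ulie gr P vac x ∈ ULieDeg gr P vac (lsymDeg x) :=
  Submodule.subset_span ⟨[x], by simp, by simp⟩

theorem ULieDeg_mul_ulie {d : ℤ} {y : ULie gr P vac} (hy : y ∈ ULieDeg gr P vac d)
    (x : LSym gr) : y * ulie gr P vac x ∈ ULieDeg gr P vac (d + lsymDeg x) := by
  unfold ULieDeg at hy
  induction hy using Submodule.span_induction with
  | mem y hy =>
    obtain ⟨l, hl, rfl⟩ := hy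
    exact Submodule.subset_span ⟨l ++ [x], by simp [hl], by simp⟩
  | zero => rw [zero_mul]; exact zero_mem _
  | add a b _ _ ha hb => rw [add_mul]; exact add_mem ha hb
  | smul c a _ ha => rw [smul_mul_assoc]; exact Submodule.smul_mem _ c ha

theorem ULieNbhd_mul (x : ULie gr P vac) :
    ∀ i : ℕ, ∃ j : ℕ, ∀ y ∈ ULieNbhd gr P vac j, y * x ∈ ULieNbhd gr P vac i := by
  obtain ⟨z, hz⟩ := RingQuot.mkAlgHom_surjective ℂ (LRel gr P vac) x
  change toULie gr P vac z = x at hz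
  subst hz
  induction z using FreeAlgebra.induction with
  | grade0 c =>
    intro i
    refine ⟨i, fun y hy => ?_⟩
    rw [AlgHom.commutes]
    rw [← Algebra.commutes]
    exact Submodule.smul_mem _ (algebraMap ℂ (ULie gr P vac) c) hy
  | grade1 g =>
    intro i
    refine ⟨((i : ℤ) - lsymDeg g).toNat, fun y hy => ?_⟩
    change y * ulie gr P vac g ∈ _
    unfold ULieNbhd at hy
    induction hy using Submodule.span_induction with
    | mem y hy =>
      obtain ⟨r, hr, hy⟩ := hy
      exact Submodule.subset_span ⟨r + lsymDeg g, by omega, ULieDeg_mul_ulie gr P vac hy g⟩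
    | zero => rw [zero_mul]; exact zero_mem _
    | add a b _ _ ha hb => rw [add_mul]; exact add_mem ha hb
    | smul c a _ ha => rw [smul_mul_assoc]; exact Submodule.smul_mem _ c ha
  | mul a b ha hb =>
    intro i
    obtain ⟨j, hj⟩ := hb i
    obtain ⟨l, hl⟩ := ha j
    refine ⟨l, fun y hy => ?_⟩
    rw [map_mul]
    have := hj _ (hl y hy)
    rwa [mul_assoc] at this
  | add a b ha hb =>
    intro i
    obtain ⟨j, hj⟩ := ha i
    obtain ⟨l, hl⟩ := hb i
    refine ⟨max j l, fun y hy => ?_⟩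
    rw [map_add]
    have h1 := hj y (ULieNbhd_anti gr P vac (le_max_left j l) hy)
    have h2 := hl y (ULieNbhd_anti gr P vac (le_max_right j l) hy)
    have := add_mem h1 h2
    rwa [← mul_add] at this

theorem ULie_basis :
    RingSubgroupsBasis fun N : ℕ => (ULieNbhd gr P vac N).toAddSubgroup where
  inter i j := ⟨max i j, le_inf (ULieNbhd_anti gr P vac (le_max_left i j))
    (ULieNbhd_anti gr P vac (le_max_right i j))⟩
  mul i := by
    refine ⟨i, ?_⟩
    rintro _ ⟨x, -, y, hy, rfl⟩
    exact Submodule.smul_mem (ULieNbhd gr P vac i) x hy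
  leftMul x i := ⟨i, fun _ hy => Submodule.smul_mem (ULieNbhd gr P vac i) x hy⟩
  rightMul x i := by
    obtain ⟨j, hj⟩ := ULieNbhd_mul gr P vac x i
    exact ⟨j, fun y hy => hj y hy⟩

/-- The linear topology on `U(L(V))` with the neighbourhood basis `∑_{r > N} U(L(V)) U(L(V))_r`. -/
noncomputable instance : TopologicalSpace (ULie gr P vac) := (ULie_basis gr P vac).topology

instance : IsTopologicalRing (ULie gr P vac) :=
  (ULie_basis gr P vac).toRingFilterBasis.isTopologicalRing

noncomputable instance : UniformSpace (ULie gr P vac) := IsTopologicalAddGroup.rightUniformSpace _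

instance : IsUniformAddGroup (ULie gr P vac) := isUniformAddGroup_of_addCommGroup

instance : UniformContinuousConstSMul ℂ (ULie gr P vac) where
  uniformContinuous_const_smul c :=
    uniformContinuous_addMonoidHom_of_continuous
      (f := DistribSMul.toAddMonoidHom (ULie gr P vac) c) (by
        have h : Continuous fun x : ULie gr P vac => algebraMap ℂ (ULie gr P vac) c * x :=
          continuous_const_mul _
        refine h.congr fun x => ?_
        exact (Algebra.smul_def c x).symm)

/-- The degreewise completion `⨁_d lim_N U(L(V))_d / ∑_{r > N} U(L(V))_{d-r} U(L(V))_r`. Its degree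
`d` part is the closure of `U(L(V))_d` in the completion of the topological ring `U(L(V))`, and it
is the subalgebra generated by these parts. -/
noncomputable def DegCompl : Subalgebra ℂ (UniformSpace.Completion (ULie gr P vac)) :=
  Algebra.adjoin ℂ (⋃ d : ℤ, closure
    ((fun x : ULie gr P vac => (x : UniformSpace.Completion (ULie gr P vac))) ''
      (ULieDeg gr P vac d : Set (ULie gr P vac))))

/-- The element `u t^a` of the degreewise completion. -/
noncomputable def compMode {Δ : ℤ} (u : gr Δ) (a : ℤ) : DegCompl gr P vac :=
  ⟨(ulie gr P vac (⟨Δ, u⟩, a) : UniformSpace.Completion (ULie gr P vac)),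
    Algebra.subset_adjoin (Set.mem_iUnion.2 ⟨_, subset_closure ⟨_, ulie_mem_deg gr P vac _, rfl⟩⟩)⟩

/-- The elements `(u_{(a)} v) t^b - ∑_{i ≥ 0} (-1)^i (a choose i)
(u t^{a-i} v t^{b+i} - (-1)^a v t^{a+b-i} u t^i)` and `|0⟩ t^{-1} - 1` of the completion. -/
inductive EnvRelator : DegCompl gr P vac → Prop
  | prod {Δ Δ' : ℤ} (u : gr Δ) (v : gr Δ') (a b : ℤ) (w : gr (Δ + Δ' - a - 1)) (h : P u a v w)
      (S : DegCompl gr P vac)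
      (hS : HasSum (fun i : ℕ => ((-1 : ℂ) ^ i * ((Ring.choose a i : ℤ) : ℂ)) •
        (compMode gr P vac u (a - i) * compMode gr P vac v (b + i)
          - ((-1 : ℂ) ^ a) • (compMode gr P vac v (a + b - i) * compMode gr P vac u i))) S) :
      EnvRelator (compMode gr P vac w b - S)
  | unit : EnvRelator (compMode gr P vac vac (-1) - 1)

/-- The completion of the two-sided ideal generated by the relators, i.e. the smallest closed
two-sided ideal of the degreewise completion containing them. -/
noncomputable def envIdeal : TwoSidedIdeal (DegCompl gr P vac) :=
  sInf {I | (∀ x, EnvRelator gr P vac x → x ∈ I) ∧ IsClosed {x | x ∈ I}}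

/-- The universal enveloping algebra `𝒰(V)` of the vertex algebra. -/
def UEnv : Type := (envIdeal gr P vac).ringCon.Quotient

noncomputable instance : Ring (UEnv gr P vac) :=
  inferInstanceAs (Ring (envIdeal gr P vac).ringCon.Quotient)
noncomputable instance : Algebra ℂ (UEnv gr P vac) :=
  inferInstanceAs (Algebra ℂ (envIdeal gr P vac).ringCon.Quotient)

/-- The element `u t^a` of `𝒰(V)`. -/
noncomputable def envMode {Δ : ℤ} (u : gr Δ) (a : ℤ) : UEnv gr P vac :=
  ((compMode gr P vac u a : DegCompl gr P vac) : (envIdeal gr P vac).ringCon.Quotient)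

end Enveloping

/-- The universal enveloping algebra `𝒰(𝒲^k(𝔤𝔩(m+n), f))`. -/
abbrev UW (k : ℂ) (m n : ℕ) : Type := UEnv (WGr k m n) (NProd k m n) (WVac k m n)

/-! ### The generators `W^{(1)}` and `W^{(2)}` -/

/-- The operator `e_{i,j}[r]` on `V^κ(𝔟)`. -/
noncomputable def eMode (k : ℂ) (m n i j : ℕ) (r : ℤ) : (bData k m n).Modes :=
  (bData k m n).mode (eB m n i j) r

/-- `W^{(1)}_{i,j}` as a vector of `V^κ(𝔟)`: the sum of all `e_{h,l}[-1]` with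
`row h = i`, `row l = j`, `col h = col l`. -/
noncomputable def W1vec (k : ℂ) (m n i j : ℕ) : VB k m n :=
  ∑ x ∈ (Finset.Icc 1 (m + n) ×ˢ Finset.Icc 1 (m + n)).filter
      (fun x => row m n x.1 = i ∧ row m n x.2 = j ∧ col m x.1 = col m x.2),
    eMode k m n x.1 x.2 (-1) • (bData k m n).vac

/-- `W^{(2)}_{i,j}` as a vector of `V^κ(𝔟)`; here `î = i + n` for `m - n < i ≤ m`. -/
noncomputable def W2vec (k : ℂ) (m n i j : ℕ) : VB k m n :=
  eMode k m n (i + n) j (-1) • (bData k m n).vac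
  - alpha2 k m • eMode k m n i j (-2) • (bData k m n).vac
  + ∑ u ∈ Finset.Ioc (m - n) m,
      eMode k m n u j (-1) • eMode k m n (i + n) (u + n) (-1) • (bData k m n).vac
  - ∑ u ∈ Finset.Icc 1 (m - n),
      eMode k m n u j (-1) • eMode k m n i u (-1) • (bData k m n).vac

/-- `(i,j)` is an index of a generator `W^{(1)}_{i,j}`. -/
def W1Dom (m n i j : ℕ) : Prop :=
  (i ∈ Finset.Icc 1 (m - n) ∧ j ∈ Finset.Icc 1 m) ∨
    (i ∈ Finset.Ioc (m - n) m ∧ j ∈ Finset.Ioc (m - n) m)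

/-- `(i,j)` is an index of a generator `W^{(2)}_{i,j}`. -/
def W2Dom (m n i j : ℕ) : Prop := i ∈ Finset.Ioc (m - n) m ∧ j ∈ Finset.Icc 1 m

section Membership

variable (k : ℂ) (m n : ℕ)

/-- `(i,j)` is an index of a basis vector of `𝔟`. -/
def BOk (m n i j : ℕ) : Prop :=
  (i ∈ Finset.Icc 1 (m + n) ∧ j ∈ Finset.Icc 1 (m + n)) ∧ col m j ≤ col m i

theorem eMode_eq {i j : ℕ} (h : BOk m n i j) (r : ℤ) :
    eMode k m n i j r = (bData k m n).gen ⟨(i, j), h⟩ r := by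
  have h' : (i ∈ Finset.Icc 1 (m + n) ∧ j ∈ Finset.Icc 1 (m + n)) ∧ col m j ≤ col m i := h
  unfold eMode AffineData.mode eB
  rw [dif_pos h', Finsupp.sum_single_index (by rw [zero_smul]), one_smul]

theorem eA_mode_eq {i j : ℕ} (h : BOk m n i j) (r : ℤ) :
    (aData k m n).mode (eA m n i j) r = (aData k m n).gen (Sum.inl ⟨(i, j), h⟩) r := by
  have h' : (i ∈ Finset.Icc 1 (m + n) ∧ j ∈ Finset.Icc 1 (m + n)) ∧ col m j ≤ col m i := h
  unfold AffineData.mode eA eB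
  rw [dif_pos h', Finsupp.mapDomain_single, Finsupp.sum_single_index (by rw [zero_smul]), one_smul]

theorem mode_vac {ι : Type} (D : AffineData ι) (x : ι →₀ ℂ) (r : ℤ) (hr : 0 ≤ r) :
    D.mode x r • D.vac = 0 := by
  unfold AffineData.mode Finsupp.sum
  rw [Finset.sum_smul]
  refine Finset.sum_eq_zero fun z _ => ?_
  rw [smul_assoc, D.gen_vac _ _ hr, smul_zero]

theorem fieldProd_vac {ι : Type} (D : AffineData ι) (x y : ι →₀ ℂ) :
    fieldProd (D.field x) (-1) (D.field y) (-1) D.vac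
      = D.mode x (-1) • D.mode y (-1) • D.vac := by
  unfold fieldProd AffineData.field
  rw [finsum_eq_single _ 0]
  · rw [mode_vac D x ((0 : ℕ) : ℤ) (by simp)]
    simp
  · intro i hi
    rw [mode_vac D x (i : ℤ) (by omega), mode_vac D y (-1 + (i : ℤ)) (by omega)]
    simp

theorem incl_eMode {i j : ℕ} (h : BOk m n i j) (r : ℤ) (v : VB k m n) :
    incl k m n (eMode k m n i j r • v)
      = (aData k m n).mode (eA m n i j) r • incl k m n v := by
  rw [eMode_eq k m n h, eA_mode_eq k m n h, incl_gen]

theorem d0_eMode {i j : ℕ} (h : BOk m n i j) (s : ℤ) {v : VB k m n} {w : VA k m n}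
    (hv : (v, w) ∈ d0Graph k m n) :
    (eMode k m n i j s • v, dField k m n i j s (incl k m n v)
      + (aData k m n).mode (eA m n i j) s • w) ∈ d0Graph k m n := by
  rw [eMode_eq k m n h, eA_mode_eq k m n h]
  exact IsD0.mode ⟨(i, j), h⟩ s v w hv

theorem dField_same {i j : ℕ} (h : col m i = col m j) (s : ℤ) (v : VA k m n) :
    dField k m n i j s v =
      (if m - n < i ∧ i ≤ m then psiField k m n (i + n) j s v else 0)
      - (if m < j then psiField k m n i (j - n) s v else 0) := by
  unfold dField
  rw [Finset.filter_false_of_mem (by intros; omega), Finset.filter_false_of_mem (by intros; omega),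
    if_neg (by omega)]
  simp

theorem d0_vac : ((bData k m n).vac, (0 : VA k m n)) ∈ d0Graph k m n := IsD0.vac

theorem d0_eMode_vac {i j : ℕ} (h : BOk m n i j) (s : ℤ) :
    (eMode k m n i j s • (bData k m n).vac, dField k m n i j s (aData k m n).vac)
      ∈ d0Graph k m n := by
  have := d0_eMode k m n h s (d0_vac k m n)
  rwa [smul_zero, add_zero, incl_vac] at this

theorem weight_eMode {i j : ℕ} (h : BOk m n i j) (s : ℤ) {Δ Δ' : ℤ} {v : VB k m n}
    (hv : HasWeight k m n Δ v) (hΔ : Δ' = Δ + ((col m i : ℤ) - (col m j : ℤ) - s)) :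
    HasWeight k m n Δ' (eMode k m n i j s • v) := by
  rw [eMode_eq k m n h, hΔ]
  exact HasWeight.mode ⟨(i, j), h⟩ s Δ v hv

theorem W1vec_eq (hmn : n ≤ m) {i j : ℕ} (h : W1Dom m n i j) :
    W1vec k m n i j = eMode k m n i j (-1) • (bData k m n).vac
      + if m - n < i then eMode k m n (i + n) (j + n) (-1) • (bData k m n).vac else 0 := by
  unfold W1vec
  simp only [W1Dom, Finset.mem_Icc, Finset.mem_Ioc] at h
  split_ifs with hi
  · have : (Finset.Icc 1 (m + n) ×ˢ Finset.Icc 1 (m + n)).filter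
        (fun x => row m n x.1 = i ∧ row m n x.2 = j ∧ col m x.1 = col m x.2)
        = {(i, j), (i + n, j + n)} := by
      ext ⟨a, b⟩
      rw [Finset.mem_filter]
      simp only [Finset.mem_product, Finset.mem_Icc, row, col,
        Finset.mem_insert, Finset.mem_singleton, Prod.mk.injEq]
      split_ifs <;> omega
    rw [this, Finset.sum_pair]
    simp only [ne_eq, Prod.mk.injEq]
    omega
  · have : (Finset.Icc 1 (m + n) ×ˢ Finset.Icc 1 (m + n)).filter
        (fun x => row m n x.1 = i ∧ row m n x.2 = j ∧ col m x.1 = col m x.2)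
        = {(i, j)} := by
      ext ⟨a, b⟩
      rw [Finset.mem_filter]
      simp only [Finset.mem_product, Finset.mem_Icc, row, col,
        Finset.mem_singleton, Prod.mk.injEq]
      split_ifs <;> omega
    rw [this, Finset.sum_singleton, add_zero]

theorem W1vec_mem (hmn : n ≤ m) {i j : ℕ} (h : W1Dom m n i j) :
    W1vec k m n i j ∈ WGr k m n 1 := by
  rw [W1vec_eq k m n hmn h]
  simp only [W1Dom, Finset.mem_Icc, Finset.mem_Ioc] at h
  have hij : BOk m n i j := by
    simp only [BOk, Finset.mem_Icc, col]
    split_ifs <;> omega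
  have hc : col m i = col m j := by
    simp only [col]
    split_ifs <;> omega
  have w1 : eMode k m n i j (-1) • (bData k m n).vac ∈ weightSpace k m n 1 :=
    Submodule.subset_span (weight_eMode k m n hij _ HasWeight.vac (by rw [hc]; simp))
  have d1 := d0_eMode_vac k m n hij (-1)
  rw [dField_same k m n hc, if_neg (by omega : ¬ m < j), sub_zero] at d1
  split_ifs with hi
  · have hij2 : BOk m n (i + n) (j + n) := by
      simp only [BOk, Finset.mem_Icc, col]
      split_ifs <;> omega
    have hc2 : col m (i + n) = col m (j + n) := by
      simp only [col]
      split_ifs <;> omega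
    have w2 : eMode k m n (i + n) (j + n) (-1) • (bData k m n).vac ∈ weightSpace k m n 1 :=
      Submodule.subset_span (weight_eMode k m n hij2 _ HasWeight.vac (by rw [hc2]; simp))
    have d2 := d0_eMode_vac k m n hij2 (-1)
    rw [dField_same k m n hc2, if_neg (by omega), if_pos (by omega : m < j + n),
      Nat.add_sub_cancel, zero_sub] at d2
    rw [if_pos (by omega)] at d1
    refine ⟨?_, add_mem w1 w2⟩
    have := add_mem d1 d2
    rw [Prod.mk_add_mk, add_neg_cancel] at this
    exact this
  · rw [if_neg (by omega)] at d1
    rw [add_zero]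
    exact ⟨d1, w1⟩

theorem W2vec_mem (hmn : n ≤ m) {i j : ℕ} (h : W2Dom m n i j) :
    W2vec k m n i j ∈ WGr k m n 2 := by
  simp only [W2Dom, Finset.mem_Icc, Finset.mem_Ioc] at h
  have b1 : BOk m n (i + n) j := by
    simp only [BOk, Finset.mem_Icc, col]
    split_ifs <;> omega
  have b2 : BOk m n i j := by
    simp only [BOk, Finset.mem_Icc, col]
    split_ifs <;> omega
  have b3 : ∀ u ∈ Finset.Ioc (m - n) m, BOk m n u j ∧ BOk m n (i + n) (u + n) := by
    intro u hu
    simp only [BOk, Finset.mem_Icc, Finset.mem_Ioc, col] at hu ⊢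
    split_ifs <;> omega
  have b4 : ∀ u ∈ Finset.Icc 1 (m - n), BOk m n u j ∧ BOk m n i u := by
    intro u hu
    simp only [BOk, Finset.mem_Icc, col] at hu ⊢
    split_ifs <;> omega
  have cj : col m j = 1 := if_pos (by omega)
  have ci : col m i = 1 := if_pos (by omega)
  have cin : col m (i + n) = 2 := if_neg (by omega)
  have wt : W2vec k m n i j ∈ weightSpace k m n 2 := by
    unfold W2vec
    refine sub_mem (add_mem (sub_mem ?_ (Submodule.smul_mem _ _ ?_)) (sum_mem fun u hu => ?_))
      (sum_mem fun u hu => ?_) <;> refine Submodule.subset_span ?_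
    · exact weight_eMode k m n b1 _ HasWeight.vac (by rw [cj, cin]; norm_num)
    · exact weight_eMode k m n b2 _ HasWeight.vac (by rw [cj, ci]; norm_num)
    · have hu' := Finset.mem_Ioc.1 hu
      have cu : col m u = 1 := if_pos (by omega)
      have cun : col m (u + n) = 2 := if_neg (by omega)
      exact weight_eMode k m n (b3 u hu).1 _
        (weight_eMode k m n (b3 u hu).2 _ HasWeight.vac rfl) (by rw [cj, cin, cu, cun]; norm_num)
    · have hu' := Finset.mem_Icc.1 hu
      have cu : col m u = 1 := if_pos (by omega)
      exact weight_eMode k m n (b4 u hu).1 _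
        (weight_eMode k m n (b4 u hu).2 _ HasWeight.vac rfl) (by rw [cj, ci, cu]; norm_num)
  refine ⟨?_, wt⟩
  let e (a b : ℕ) (s : ℤ) : (aData k m n).Modes := (aData k m n).mode (eA m n a b) s
  let ψ (a b : ℕ) (s : ℤ) : (aData k m n).Modes := (aData k m n).mode (psiA m n a b) s
  have d1 := d0_eMode_vac k m n b1 (-1)
  have d2 := d0_eMode_vac k m n b2 (-2)
  have D1 : dField k m n (i + n) j (-1) (aData k m n).vac =
      ∑ u ∈ Finset.Icc 1 (m - n), e u j (-1) • ψ (i + n) u (-1) • (aData k m n).vac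
      + ∑ u ∈ Finset.Ioc (m - n) m, e u j (-1) • ψ (i + n) u (-1) • (aData k m n).vac
      - ∑ u ∈ Finset.Ioc (m - n) m, ψ (u + n) j (-1) • e (i + n) (u + n) (-1) • (aData k m n).vac
      + alpha2 k m • ψ (i + n) j (-2) • (aData k m n).vac := by
    have f1 : (Finset.Icc 1 (m + n)).filter
        (fun r => col m r < col m (i + n) ∧ col m j ≤ col m r)
        = Finset.Icc 1 (m - n) ∪ Finset.Ioc (m - n) m := by
      ext r
      rw [cj, cin]
      rw [Finset.mem_filter]
      simp only [Finset.mem_union, Finset.mem_Icc, Finset.mem_Ioc, col]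
      split_ifs <;> omega
    have f2 : (Finset.Icc 1 (m + n)).filter
        (fun r => col m j < col m r ∧ col m r ≤ col m (i + n))
        = (Finset.Ioc (m - n) m).image (fun u => u + n) := by
      ext r
      rw [cj, cin]
      rw [Finset.mem_filter]
      simp only [Finset.mem_image, Finset.mem_Icc, Finset.mem_Ioc, col]
      constructor
      · intro hr
        refine ⟨r - n, ?_, ?_⟩ <;> split_ifs at hr <;> omega
      · rintro ⟨u, hu, rfl⟩
        split_ifs <;> omega
    have dj : Disjoint (Finset.Icc 1 (m - n)) (Finset.Ioc (m - n) m) := by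
      rw [Finset.disjoint_left]
      intro a ha hb
      simp only [Finset.mem_Icc, Finset.mem_Ioc] at ha hb
      omega
    unfold dField
    rw [f1, f2, Finset.sum_union dj, Finset.sum_image (by intro a _ b _ hab; simpa using hab),
      if_pos (by omega), if_neg (by omega), if_neg (by omega)]
    simp only [eField, psiField, fieldProd_vac, add_zero, sub_zero]
    norm_num [AffineData.field, e, ψ]
  have D2 : dField k m n i j (-2) (aData k m n).vac = ψ (i + n) j (-2) • (aData k m n).vac := by
    rw [dField_same k m n (by rw [ci, cj]), if_pos (by omega), if_neg (by omega), sub_zero]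
    rfl
  rw [D1] at d1
  rw [D2] at d2
  have d3 : ∀ u ∈ Finset.Ioc (m - n) m,
      (eMode k m n u j (-1) • eMode k m n (i + n) (u + n) (-1) • (bData k m n).vac,
        ψ (u + n) j (-1) • e (i + n) (u + n) (-1) • (aData k m n).vac
          - e u j (-1) • ψ (i + n) u (-1) • (aData k m n).vac) ∈ d0Graph k m n := by
    intro u hu
    have hu' := Finset.mem_Ioc.1 hu
    have cu : col m u = 1 := if_pos (by omega)
    have cun : col m (u + n) = 2 := if_neg (by omega)
    have := d0_eMode k m n (b3 u hu).1 (-1) (d0_eMode_vac k m n (b3 u hu).2 (-1))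
    rw [dField_same k m n (by rw [cu, cj]), dField_same k m n (by rw [cin, cun]),
      if_pos (by omega), if_neg (by omega), if_neg (by omega), if_pos (by omega),
      incl_eMode k m n (b3 u hu).2, incl_vac, Nat.add_sub_cancel, sub_zero, zero_sub, smul_neg,
      ← sub_eq_add_neg] at this
    exact this
  have d4 : ∀ u ∈ Finset.Icc 1 (m - n),
      (eMode k m n u j (-1) • eMode k m n i u (-1) • (bData k m n).vac,
        e u j (-1) • ψ (i + n) u (-1) • (aData k m n).vac) ∈ d0Graph k m n := by
    intro u hu
    have hu' := Finset.mem_Icc.1 hu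
    have cu : col m u = 1 := if_pos (by omega)
    have := d0_eMode k m n (b4 u hu).1 (-1) (d0_eMode_vac k m n (b4 u hu).2 (-1))
    rw [dField_same k m n (by rw [cu, cj]), dField_same k m n (by rw [ci, cu]),
      if_neg (by omega), if_neg (by omega), if_pos (by omega), if_neg (by omega),
      sub_zero, zero_add, sub_zero] at this
    exact this
  have key := sub_mem (add_mem (sub_mem d1 (Submodule.smul_mem _ (alpha2 k m) d2)) (sum_mem d3))
    (sum_mem d4)
  change (W2vec k m n i j, (0 : VA k m n)) ∈ d0Graph k m n
  convert key using 1
  ext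
  · simp only [W2vec, Prod.fst_sub, Prod.fst_add, Prod.smul_fst, Prod.fst_sum]
  · simp only [Prod.snd_sub, Prod.snd_add, Prod.smul_snd, Prod.snd_sum, Finset.sum_sub_distrib]
    abel

end Membership

/-- The element `W^{(1)}_{i,j}` of the `W`-algebra. -/
noncomputable def W1 (k : ℂ) {m n : ℕ} (hmn : n ≤ m) (i j : ℕ) (h : W1Dom m n i j) :
    WGr k m n 1 :=
  ⟨W1vec k m n i j, W1vec_mem k m n hmn h⟩

/-- The element `W^{(2)}_{i,j}` of the `W`-algebra. -/
noncomputable def W2 (k : ℂ) {m n : ℕ} (hmn : n ≤ m) (i j : ℕ) (h : W2Dom m n i j) :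
    WGr k m n 2 :=
  ⟨W2vec k m n i j, W2vec_mem k m n hmn h⟩

/-- The element `u t^s` of `𝒰(𝒲^k(𝔤𝔩(m+n), f))`, for `u` in the weight `Δ` part. -/
noncomputable def wMode {k : ℂ} {m n : ℕ} {Δ : ℤ} (u : WGr k m n Δ) (s : ℤ) : UW k m n :=
  envMode (WGr k m n) (NProd k m n) (WVac k m n) u s

theorem W1Dom.large {m n i j : ℕ} (hi : i ∈ Finset.Ioc (m - n) m) (hj : j ∈ Finset.Ioc (m - n) m) :
    W1Dom m n i j := Or.inr ⟨hi, hj⟩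

theorem W1Dom.small {m n : ℕ} (w : {w : ℕ // w ∈ Finset.Icc 1 (m - n)}) : W1Dom m n w w := by
  have hw := Finset.mem_Icc.1 w.2
  exact Or.inl ⟨w.2, Finset.mem_Icc.2 ⟨hw.1, by omega⟩⟩

theorem W2Dom.large {m n i j : ℕ} (hi : i ∈ Finset.Ioc (m - n) m) (hj : j ∈ Finset.Ioc (m - n) m) :
    W2Dom m n i j := by
  have h := Finset.mem_Ioc.1 hj
  exact ⟨hi, Finset.mem_Icc.2 ⟨by omega, h.2⟩⟩

/-!
The commutator formula of the Borcherds Lie algebra, `[x t^s, y t^u] = ∑_{r ≥ 0} (s choose r)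
(x_{(r)} y) t^{s+u-r}`, holds in `𝒰(𝒲)` (`envMode_comm`), so everything rests on the products
`(W^{(1)}_{p,q})_{(r)} W^{(2)}_{i,j}` with `r ≥ 0` in `V^κ(𝔟)`.

For `p, q > m - n` the field of `W^{(1)}_{p,q}` is `e_{p,q}(z) + e_{p̂,q̂}(z)` (`nProd_W1vec`). Its
modes with `r ≥ 0` kill the vacuum, so that the products follow by moving them to the right with
the affine commutation relations (`eMode_smul`).

* For `r = 0` the action is that of the diagonal matrix unit of `𝔤𝔩_n`, for which `W^{(2)}` is a
  matrix of adjoint type: the sums over intermediate indices `u` are contractions, so that their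
  inner contributions cancel or vanish (`diagMode_zero_W2vec`).
* For `r = 1` the form contributes terms linear in `𝔟`, and the quadratic terms with `u ≤ m - n`
  contribute a double commutator. The latter replaces `α₂` by `α₂ - (m - n) = α₁` in the
  coefficient of `e_{i,q}` and supplies the sum of the `W^{(1)}_{w,w}` (`diagMode_one_W2vec`).
* For `r = 2` only multiples of the vacuum remain (`diagMode_two_W2vec`), and for `r ≥ 3` nothing
  does (`diagMode_ge_three_W2vec`).

The scalars of the statement come from the `r = 2` product, as `|0⟩ t^a = δ_{a,-1}` in `𝒰(𝒲)`
(`wMode_WVac`): `|0⟩ t^{-1} = 1` is a defining relation, and `∂|0⟩ = 0` forces `|0⟩ t^a = 0` for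
the other `a`.
-/

/-! ### Relations in the enveloping algebra of a vertex algebra -/

section Enveloping

variable {V : Type} [AddCommGroup V] [Module ℂ V] (gr : ℤ → Submodule ℂ V)
  (P : V → ℤ → V → V → Prop) (vac : gr 0)

/-- The quotient map from the degreewise completion onto `𝒰(V)`. -/
noncomputable def toUEnv : DegCompl gr P vac →ₐ[ℂ] UEnv gr P vac where
  toRingHom := (envIdeal gr P vac).ringCon.mk'
  commutes' _ := rfl

theorem toUEnv_compMode {Δ : ℤ} (u : gr Δ) (a : ℤ) :
    toUEnv gr P vac (compMode gr P vac u a) = envMode gr P vac u a := rfl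

theorem toUEnv_eq_zero {x : DegCompl gr P vac} (hx : EnvRelator gr P vac x) :
    toUEnv gr P vac x = 0 := by
  have hmem : x ∈ envIdeal gr P vac := by
    unfold envIdeal
    rw [TwoSidedIdeal.mem_sInf]
    rintro I ⟨hI, -⟩
    exact hI x hx
  exact (RingCon.eq _).2 ((TwoSidedIdeal.mem_iff _ _).1 hmem)

theorem compMode_val {Δ : ℤ} (u : gr Δ) (a : ℤ) :
    (compMode gr P vac u a : UniformSpace.Completion (ULie gr P vac))
      = (toULie gr P vac (lsym u a) : ULie gr P vac) := rfl

theorem toULie_rel {x y : FreeAlgebra ℂ (LSym gr)} (h : LRel gr P vac x y) :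
    toULie gr P vac x = toULie gr P vac y :=
  RingQuot.mkAlgHom_rel ℂ h

theorem envMode_add {Δ : ℤ} (u v : gr Δ) (a : ℤ) :
    envMode gr P vac (u + v) a = envMode gr P vac u a + envMode gr P vac v a := by
  have h : compMode gr P vac (u + v) a = compMode gr P vac u a + compMode gr P vac v a := by
    ext
    rw [Subalgebra.coe_add, compMode_val, compMode_val, compMode_val,
      toULie_rel gr P vac (LRel.sum u v a), map_add, UniformSpace.Completion.coe_add]
  rw [← toUEnv_compMode, h, map_add, toUEnv_compMode, toUEnv_compMode]

theorem envMode_smul {Δ : ℤ} (c : ℂ) (u : gr Δ) (a : ℤ) :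
    envMode gr P vac (c • u) a = c • envMode gr P vac u a := by
  have h : compMode gr P vac (c • u) a = c • compMode gr P vac u a := by
    ext
    rw [Subalgebra.coe_smul, compMode_val, compMode_val,
      toULie_rel gr P vac (LRel.scal c u a), map_smul, UniformSpace.Completion.coe_smul]
  rw [← toUEnv_compMode, h, map_smul, toUEnv_compMode]

/-- The element `u t^a` as a linear function of `u`. -/
noncomputable def envModeLin (Δ a : ℤ) : gr Δ →ₗ[ℂ] UEnv gr P vac where
  toFun u := envMode gr P vac u a
  map_add' u v := envMode_add gr P vac u v a
  map_smul' c u := envMode_smul gr P vac c u a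

theorem envModeLin_apply {Δ : ℤ} (u : gr Δ) (a : ℤ) :
    envModeLin gr P vac Δ a u = envMode gr P vac u a := rfl

theorem envMode_vac_neg_one : envMode gr P vac vac (-1) = 1 := by
  have h := toUEnv_eq_zero gr P vac EnvRelator.unit
  rwa [map_sub, map_one, sub_eq_zero, toUEnv_compMode] at h

/-- Since `∂|0⟩ = 0`, the translation relation kills `|0⟩ t^a` for `a ≠ -1`. -/
theorem envMode_vac (hvac : P vac (-2) vac 0) (a : ℤ) :
    envMode gr P vac vac a = if a = -1 then 1 else 0 := by
  split_ifs with ha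
  · rw [ha, envMode_vac_neg_one]
  · have h : compMode gr P vac (0 : gr (0 + 1)) (a + 1)
        = (-((a + 1 : ℤ) : ℂ)) • compMode gr P vac vac a := by
      ext
      rw [Subalgebra.coe_smul, compMode_val, compMode_val,
        toULie_rel gr P vac (LRel.deriv vac 0 (a + 1) hvac), map_smul,
        UniformSpace.Completion.coe_smul, add_sub_cancel_right]
    have h' := congrArg (toUEnv gr P vac) h
    rw [map_smul, toUEnv_compMode, toUEnv_compMode, ← envModeLin_apply, map_zero, eq_comm,
      smul_eq_zero] at h'
    refine h'.resolve_left ?_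
    rw [neg_eq_zero, Int.cast_eq_zero]
    omega

/-- The commutator formula of the Borcherds Lie algebra, in `𝒰(V)`. -/
theorem envMode_comm {Δ Δ' : ℤ} (u : gr Δ) (v : gr Δ') (a b : ℤ)
    (w : (r : ℕ) → gr (Δ + Δ' - r - 1)) (N : ℕ)
    (h : ∀ r : ℕ, P u r v (w r)) (hN : ∀ r : ℕ, N ≤ r → w r = 0) :
    envMode gr P vac u a * envMode gr P vac v b - envMode gr P vac v b * envMode gr P vac u a
      = ∑ r ∈ Finset.range N,
          ((Ring.choose a r : ℤ) : ℂ) • envMode gr P vac (w r) (a + b - r) := by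
  have key : compMode gr P vac u a * compMode gr P vac v b
      = compMode gr P vac v b * compMode gr P vac u a
        + ∑ r ∈ Finset.range N,
          ((Ring.choose a r : ℤ) : ℂ) • compMode gr P vac (w r) (a + b - r) := by
    ext
    have hrel := congrArg (UniformSpace.Completion.coeRingHom : ULie gr P vac →+* _)
      (toULie_rel gr P vac (LRel.comm u v a b w N h hN))
    simp only [map_add, map_mul, map_sum, map_smul] at hrel
    rw [Subalgebra.coe_add, Subalgebra.coe_mul, Subalgebra.coe_mul, AddSubmonoidClass.coe_finsetSum]
    refine hrel.trans (congrArg₂ _ rfl (Finset.sum_congr rfl fun r _ => ?_))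
    rw [Subalgebra.coe_smul, compMode_val]
    exact UniformSpace.Completion.coe_smul _ _
  have key' := congrArg (toUEnv gr P vac) key
  simp only [map_add, map_mul, map_sum, map_smul, toUEnv_compMode] at key'
  rw [key', add_sub_cancel_left]

end Enveloping

/-! ### Fields and commutators of the matrix units -/

section Products

theorem sign_mul_choose_neg_one (i : ℕ) :
    (-1 : ℂ) ^ i * ((Ring.choose (-1 : ℤ) i : ℤ) : ℂ) = 1 := by
  have h : Ring.choose (-1 : ℤ) i = (-1) ^ i := by
    rw [Ring.choose_neg, show (1 : ℤ) + i - 1 = i by ring, Ring.choose_natCast, Nat.choose_self,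
      Nat.cast_one, Int.negOnePow_def, zpow_natCast, Units.smul_def]
    simp
  rw [h]
  push_cast
  rw [← mul_pow]
  norm_num

/-- The identity field is a right unit for the `(-1)`-product of fields. -/
theorem fieldProd_neg_one_id {V : Type} [AddCommGroup V] [Module ℂ V] (A : ℤ → V → V)
    (hA : ∀ r, A r 0 = 0) :
    fieldProd A (-1) (fun r v => if r = -1 then v else 0) = A := by
  funext s v
  unfold fieldProd
  simp only [sign_mul_choose_neg_one, one_smul]
  -- Of the two halves of the product, the creation part has its only term at `i = -1 - s`, and
  -- the annihilation part at `i = s`.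
  rw [finsum_eq_single _ (if 0 ≤ s then s.toNat else (-1 - s).toNat)]
  · split_ifs with h1 h2 h3 h4 h5 <;> try omega
    · rw [hA, Int.toNat_of_nonneg h1]
      norm_num
    · rw [Int.toNat_of_nonneg (by omega), smul_zero, sub_zero]
      congr 1
      omega
  · intro i hi
    rw [if_neg, if_neg, hA, smul_zero, sub_zero]
    all_goals
      split_ifs at hi <;> omega

variable (k : ℂ) (m n : ℕ)

theorem AffineData.mode_sub {ι : Type} (D : AffineData ι) (x y : ι →₀ ℂ) (r : ℤ) :
    D.mode (x - y) r = D.mode x r - D.mode y r :=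
  Finsupp.sum_sub_index (by intros; rw [sub_smul])

/-- The commutation relation of the elements `e_{a,b} t^r`. -/
theorem eMode_mul {a b c d : ℕ} (h : BOk m n a b) (h' : BOk m n c d) (r s : ℤ) :
    eMode k m n a b r * eMode k m n c d s = eMode k m n c d s * eMode k m n a b r
      + ((if b = c then eMode k m n a d (r + s) else 0)
        - (if a = d then eMode k m n c b (r + s) else 0))
      + algebraMap ℂ _ (if r + s = 0 then (r : ℂ) * kappaForm k m n a b c d else 0) := by
  have hb : (bData k m n).bracket ⟨(a, b), h⟩ ⟨(c, d), h'⟩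
      = (if b = c then eB m n a d else 0) - (if a = d then eB m n c b else 0) := rfl
  rw [eMode_eq k m n h, eMode_eq k m n h', AffineData.gen_comm, hb, AffineData.mode_sub]
  congr 2
  · exact (congrArg (· • _) (pow_zero _)).trans (one_smul _ _)
  · congr 1 <;> split_ifs <;> rfl

theorem eMode_smul {a b c d : ℕ} (h : BOk m n a b) (h' : BOk m n c d) (r s : ℤ) (v : VB k m n) :
    eMode k m n a b r • eMode k m n c d s • v = eMode k m n c d s • eMode k m n a b r • v
      + ((if b = c then eMode k m n a d (r + s) • v else 0)
        - (if a = d then eMode k m n c b (r + s) • v else 0))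
      + (if r + s = 0 then (r : ℂ) * kappaForm k m n a b c d else 0) • v := by
  have key := congrArg (· • v) (eMode_mul k m n h h' r s)
  simp only [add_smul, sub_smul, mul_smul, ite_smul, zero_smul, algebraMap_smul] at key
  rw [key]
  simp only [ite_smul, zero_smul, mul_smul]

theorem eMode_vac (a b : ℕ) {r : ℤ} (hr : 0 ≤ r) :
    eMode k m n a b r • (bData k m n).vac = 0 :=
  mode_vac (bData k m n) _ r hr

theorem eMode_eMode_vac {a b c d : ℕ} (h : BOk m n a b) (h' : BOk m n c d) {r : ℤ} (hr : 0 ≤ r)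
    (s : ℤ) :
    eMode k m n a b r • eMode k m n c d s • (bData k m n).vac
      = ((if b = c then eMode k m n a d (r + s) • (bData k m n).vac else 0)
        - (if a = d then eMode k m n c b (r + s) • (bData k m n).vac else 0))
      + (if r + s = 0 then (r : ℂ) * kappaForm k m n a b c d else 0) • (bData k m n).vac := by
  rw [eMode_smul k m n h h', eMode_vac k m n a b hr, smul_zero, zero_add]

theorem isStateField_eMode {a b : ℕ} (h : BOk m n a b) :
    IsStateField k m n (eMode k m n a b (-1) • (bData k m n).vac)
      (fun r v => eMode k m n a b r • v) := by
  have := IsStateField.mode (k := k) ⟨(a, b), h⟩ (-1) _ _ IsStateField.vac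
  rw [fieldProd_neg_one_id _ (fun r => smul_zero _)] at this
  simpa only [eMode_eq k m n h] using this

/-- The field of `W^{(1)}_{p,q}` for `p, q > m - n` is `e_{p,q}(z) + e_{p̂,q̂}(z)`. -/
theorem nProd_W1vec (hmn : n ≤ m) {p q : ℕ} (hp : p ∈ Finset.Ioc (m - n) m)
    (hq : q ∈ Finset.Ioc (m - n) m) (r : ℤ) (v : VB k m n) :
    NProd k m n (W1vec k m n p q) r v
      (eMode k m n p q r • v + eMode k m n (p + n) (q + n) r • v) := by
  rw [W1vec_eq k m n hmn (.large hp hq)]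
  rw [Finset.mem_Ioc] at hp hq
  rw [if_pos hp.1]
  refine ⟨_, IsStateField.sum _ _ _ _ (isStateField_eMode k m n ?_) (isStateField_eMode k m n ?_),
    rfl⟩ <;> simp only [BOk, Finset.mem_Icc, col] <;> split_ifs <;> omega

theorem kappaForm_small {a b c d : ℕ} (ha : a ≤ m) (hb : b ≤ m) (hc : c ≤ m) (hd : d ≤ m) :
    kappaForm k m n a b c d
      = (if a = d ∧ c = b then alpha1 k n else 0) + (if a = b ∧ c = d then 1 else 0) :=
  if_pos ⟨ha, hb, hc, hd⟩

theorem kappaForm_large {a b c d : ℕ} (ha : m < a) (hb : m < b) (hc : m < c) (hd : m < d) :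
    kappaForm k m n a b c d
      = (if a = d ∧ c = b then alpha2 k m else 0) + (if a = b ∧ c = d then 1 else 0) := by
  rw [kappaForm, if_neg (by omega), if_pos ⟨ha, hb, hc, hd⟩]

theorem kappaForm_mixed {a b c d : ℕ} (h : a ≤ m ∨ b ≤ m ∨ c ≤ m ∨ d ≤ m)
    (h' : m < a ∨ m < b ∨ m < c ∨ m < d) : kappaForm k m n a b c d = 0 := by
  rw [kappaForm, if_neg (by omega), if_neg (by omega)]

end Products

/-! ### The products of `W^{(1)}` with `W^{(2)}` -/

section W1W2

variable (k : ℂ) {m n : ℕ} {p q i j : ℕ}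

theorem bOk_iff {a b : ℕ} : BOk m n a b ↔
    1 ≤ a ∧ a ≤ m + n ∧ 1 ≤ b ∧ b ≤ m + n ∧ (m < b → m < a) := by
  simp only [BOk, Finset.mem_Icc, col]
  split_ifs <;> omega

/-- The operator `(W^{(1)}_{p,q})_{(r)} = e_{p,q}[r] + e_{p̂,q̂}[r]` for `m - n < p, q ≤ m`. -/
noncomputable def diagMode (k : ℂ) (m n p q : ℕ) (r : ℤ) : (bData k m n).Modes :=
  eMode k m n p q r + eMode k m n (p + n) (q + n) r

/-! The four families of terms of `W^{(2)}_{i,j}` under `diagMode`: the leading term `e_{î,j}[-1]`,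
the derivative term `e_{i,j}[-2]`, and the quadratic terms with `u > m - n` and with
`u ≤ m - n`. -/

theorem diagMode_lower (hp : p ∈ Finset.Ioc (m - n) m) (hq : q ∈ Finset.Ioc (m - n) m)
    (hi : i ∈ Finset.Ioc (m - n) m) (hj : j ∈ Finset.Ioc (m - n) m) {r : ℤ} (hr : 0 ≤ r) :
    diagMode k m n p q r • eMode k m n (i + n) j (-1) • (bData k m n).vac
      = (if q = i then eMode k m n (p + n) j (r - 1) • (bData k m n).vac else 0)
        - (if p = j then eMode k m n (i + n) q (r - 1) • (bData k m n).vac else 0) := by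
  rw [Finset.mem_Ioc] at hp hq hi hj
  rw [diagMode, add_smul,
    eMode_eMode_vac k m n (bOk_iff.2 (by omega)) (bOk_iff.2 (by omega)) hr,
    eMode_eMode_vac k m n (bOk_iff.2 (by omega)) (bOk_iff.2 (by omega)) hr,
    kappaForm_mixed k m n (by omega) (by omega), kappaForm_mixed k m n (by omega) (by omega),
    if_neg (show q ≠ i + n by omega), if_neg (show p + n ≠ j by omega)]
  simp only [add_left_inj, mul_zero, ite_self, zero_smul, add_zero, sub_zero, zero_sub,
    ← sub_eq_add_neg]
  abel

theorem diagMode_diag (hp : p ∈ Finset.Ioc (m - n) m) (hq : q ∈ Finset.Ioc (m - n) m)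
    (hi : i ∈ Finset.Ioc (m - n) m) (hj : j ∈ Finset.Ioc (m - n) m) {r : ℤ} (hr : 0 ≤ r) :
    diagMode k m n p q r • eMode k m n i j (-2) • (bData k m n).vac
      = (if q = i then eMode k m n p j (r - 2) • (bData k m n).vac else 0)
        - (if p = j then eMode k m n i q (r - 2) • (bData k m n).vac else 0)
        + (if r = 2 then 2 * ((if p = j ∧ q = i then alpha1 k n else 0)
            + (if p = q ∧ i = j then 1 else 0)) else 0) • (bData k m n).vac := by
  rw [Finset.mem_Ioc] at hp hq hi hj
  rw [diagMode, add_smul,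
    eMode_eMode_vac k m n (bOk_iff.2 (by omega)) (bOk_iff.2 (by omega)) hr,
    eMode_eMode_vac k m n (bOk_iff.2 (by omega)) (bOk_iff.2 (by omega)) hr,
    kappaForm_small k m n (by omega) (by omega) (by omega) (by omega),
    kappaForm_mixed k m n (by omega) (by omega),
    if_neg (show q + n ≠ i by omega), if_neg (show p + n ≠ j by omega)]
  simp only [mul_zero, ite_self, zero_smul, add_zero, sub_zero, ← sub_eq_add_neg,
    eq_comm (a := i) (b := q)]
  congr 2
  by_cases h : r = 2
  · subst h
    simp
  · rw [if_neg h, if_neg (by omega)]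

theorem diagMode_large (hp : p ∈ Finset.Ioc (m - n) m) (hq : q ∈ Finset.Ioc (m - n) m)
    (hi : i ∈ Finset.Ioc (m - n) m) (hj : j ∈ Finset.Ioc (m - n) m) {r : ℤ} (hr : 0 ≤ r)
    {u : ℕ} (hu : u ∈ Finset.Ioc (m - n) m) :
    diagMode k m n p q r •
        eMode k m n u j (-1) • eMode k m n (i + n) (u + n) (-1) • (bData k m n).vac
      = (if q = u then eMode k m n p j (r - 1) •
            eMode k m n (i + n) (u + n) (-1) • (bData k m n).vac else 0)
        - (if p = j then eMode k m n u q (r - 1) •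
            eMode k m n (i + n) (u + n) (-1) • (bData k m n).vac else 0)
        + (if q = i then eMode k m n u j (-1) •
            eMode k m n (p + n) (u + n) (r - 1) • (bData k m n).vac else 0)
        - (if p = u then eMode k m n u j (-1) •
            eMode k m n (i + n) (q + n) (r - 1) • (bData k m n).vac else 0)
        + (if r = 1 then ((if p = j ∧ q = u then alpha1 k n else 0)
            + (if p = q ∧ u = j then 1 else 0)) else 0) •
              eMode k m n (i + n) (u + n) (-1) • (bData k m n).vac
        + (if r = 1 then ((if p = u ∧ q = i then alpha2 k m else 0)
            + (if p = q ∧ i = u then 1 else 0)) else 0) •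
              eMode k m n u j (-1) • (bData k m n).vac := by
  rw [Finset.mem_Ioc] at hp hq hi hj hu
  rw [diagMode, add_smul,
    eMode_smul k m n (a := p) (c := u) (bOk_iff.2 (by omega)) (bOk_iff.2 (by omega)),
    eMode_smul k m n (a := p + n) (c := u) (bOk_iff.2 (by omega)) (bOk_iff.2 (by omega)),
    eMode_eMode_vac k m n (bOk_iff.2 (by omega)) (bOk_iff.2 (by omega)) hr,
    eMode_eMode_vac k m n (bOk_iff.2 (by omega)) (bOk_iff.2 (by omega)) hr,
    kappaForm_small k m n (a := p) (c := u) (by omega) (by omega) (by omega) (by omega),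
    kappaForm_large k m n (a := p + n) (c := i + n) (by omega) (by omega) (by omega) (by omega),
    kappaForm_mixed k m n (a := p) (c := i + n) (by omega) (by omega),
    kappaForm_mixed k m n (a := p + n) (c := u) (by omega) (by omega),
    if_neg (show q + n ≠ u by omega), if_neg (show p + n ≠ j by omega),
    if_neg (show q ≠ i + n by omega), if_neg (show p ≠ u + n by omega)]
  simp only [mul_zero, ite_self, zero_smul, add_zero, sub_zero, ← sub_eq_add_neg, zero_add,
    eq_comm (a := u) (b := q), eq_comm (a := i) (b := q), add_left_inj, smul_add, smul_sub,
    smul_zero, smul_ite, add_left_inj]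
  by_cases h : r = 1
  · subst h
    simp [smul_comm _ (_ : ℂ)]
    abel
  · have h' : r - 1 ≠ 0 := by omega
    simp only [h, h', if_false]
    simp only [zero_smul, smul_zero, add_zero]
    abel

theorem diagMode_small (hp : p ∈ Finset.Ioc (m - n) m) (hq : q ∈ Finset.Ioc (m - n) m)
    (hi : i ∈ Finset.Ioc (m - n) m) (hj : j ∈ Finset.Ioc (m - n) m) {r : ℤ} (hr : 0 ≤ r)
    {u : ℕ} (hu : u ∈ Finset.Icc 1 (m - n)) :
    diagMode k m n p q r • eMode k m n u j (-1) • eMode k m n i u (-1) • (bData k m n).vac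
      = (if q = i then eMode k m n u j (-1) • eMode k m n p u (r - 1) • (bData k m n).vac else 0)
        - (if p = j then eMode k m n u q (r - 1) •
            eMode k m n i u (-1) • (bData k m n).vac else 0) := by
  rw [Finset.mem_Ioc] at hp hq hi hj
  rw [Finset.mem_Icc] at hu
  rw [diagMode, add_smul,
    eMode_smul k m n (a := p) (c := u) (bOk_iff.2 (by omega)) (bOk_iff.2 (by omega)),
    eMode_smul k m n (a := p + n) (c := u) (bOk_iff.2 (by omega)) (bOk_iff.2 (by omega)),
    eMode_eMode_vac k m n (bOk_iff.2 (by omega)) (bOk_iff.2 (by omega)) hr,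
    eMode_eMode_vac k m n (bOk_iff.2 (by omega)) (bOk_iff.2 (by omega)) hr,
    kappaForm_small k m n (by omega) (by omega) (by omega) (by omega),
    kappaForm_small k m n (by omega) (by omega) (by omega) (by omega),
    kappaForm_mixed k m n (by omega) (by omega),
    kappaForm_mixed k m n (by omega) (by omega),
    if_neg (show q + n ≠ u by omega), if_neg (show p + n ≠ j by omega),
    if_neg (show q + n ≠ i by omega), if_neg (show p + n ≠ u by omega),
    if_neg (show q ≠ u by omega), if_neg (show p ≠ u by omega),
    if_neg (show ¬ (p = j ∧ u = q) by omega), if_neg (show ¬ (p = q ∧ u = j) by omega),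
    if_neg (show ¬ (p = u ∧ i = q) by omega), if_neg (show ¬ (p = q ∧ i = u) by omega)]
  simp only [mul_zero, ite_self, zero_smul, add_zero, sub_zero, ← sub_eq_add_neg, zero_sub,
    smul_zero, smul_ite, ← sub_eq_add_neg]

theorem diagMode_W2vec (r : ℤ) :
    diagMode k m n p q r • W2vec k m n i j
      = diagMode k m n p q r • eMode k m n (i + n) j (-1) • (bData k m n).vac
        - alpha2 k m • diagMode k m n p q r • eMode k m n i j (-2) • (bData k m n).vac
        + ∑ u ∈ Finset.Ioc (m - n) m, diagMode k m n p q r •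
            eMode k m n u j (-1) • eMode k m n (i + n) (u + n) (-1) • (bData k m n).vac
        - ∑ u ∈ Finset.Icc 1 (m - n), diagMode k m n p q r •
            eMode k m n u j (-1) • eMode k m n i u (-1) • (bData k m n).vac := by
  rw [W2vec, smul_sub, smul_add, smul_sub, Finset.smul_sum, Finset.smul_sum,
    smul_comm _ (alpha2 k m)]

theorem diagMode_zero_W2vec (hp : p ∈ Finset.Ioc (m - n) m) (hq : q ∈ Finset.Ioc (m - n) m)
    (hi : i ∈ Finset.Ioc (m - n) m) (hj : j ∈ Finset.Ioc (m - n) m) :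
    diagMode k m n p q 0 • W2vec k m n i j
      = - (if p = j then W2vec k m n i q else 0) + (if i = q then W2vec k m n p j else 0) := by
  rw [diagMode_W2vec, diagMode_lower k hp hq hi hj le_rfl, diagMode_diag k hp hq hi hj le_rfl,
    Finset.sum_congr rfl fun u hu => diagMode_large k hp hq hi hj le_rfl hu,
    Finset.sum_congr rfl fun u hu => diagMode_small k hp hq hi hj le_rfl hu]
  simp only [Finset.sum_add_distrib, Finset.sum_sub_distrib, Finset.sum_ite_eq, hp, hq, if_true,
    zero_sub, zero_ne_one, OfNat.zero_ne_ofNat, if_false, zero_smul, add_zero,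
    eq_comm (a := i) (b := q)]
  by_cases h1 : p = j <;> by_cases h2 : q = i <;>
    simp only [h1, h2, if_true, if_false, W2vec, Finset.sum_const_zero, sub_zero, zero_sub,
      smul_sub, smul_zero, smul_neg] <;> abel

/-- For `r ≥ 1` only the terms with one mode left survive: the quadratic terms of `W^{(2)}`
contribute through the form and, for `u ≤ m - n`, through a double commutator. -/
theorem diagMode_pos_W2vec (hp : p ∈ Finset.Ioc (m - n) m) (hq : q ∈ Finset.Ioc (m - n) m)
    (hi : i ∈ Finset.Ioc (m - n) m) (hj : j ∈ Finset.Ioc (m - n) m) {r : ℤ} (hr : 1 ≤ r) :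
    diagMode k m n p q r • W2vec k m n i j
      = - alpha2 k m • ((if q = i then eMode k m n p j (r - 2) • (bData k m n).vac else 0)
          - (if p = j then eMode k m n i q (r - 2) • (bData k m n).vac else 0)
          + (if r = 2 then 2 * ((if p = j ∧ q = i then alpha1 k n else 0)
              + (if p = q ∧ i = j then 1 else 0)) else 0) • (bData k m n).vac)
        + (if r = 1 then
            (if p = j then alpha1 k n • eMode k m n (i + n) (q + n) (-1) • (bData k m n).vac else 0)
            + (if p = q then eMode k m n (i + n) (j + n) (-1) • (bData k m n).vac else 0)
            + (if q = i then alpha2 k m • eMode k m n p j (-1) • (bData k m n).vac else 0)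
            + (if p = q then eMode k m n i j (-1) • (bData k m n).vac else 0) else 0)
        + (if p = j then ∑ u ∈ Finset.Icc 1 (m - n),
            ((if q = i then eMode k m n u u (r - 2) • (bData k m n).vac else 0)
              - eMode k m n i q (r - 2) • (bData k m n).vac
              + (if r = 2 then (if q = i then alpha1 k n else 0) else 0) • (bData k m n).vac)
            else 0) := by
  have hr0 : 0 ≤ r := by omega
  have hr1 : 0 ≤ r - 1 := by omega
  -- Matrix units of the two diagonal blocks commute and are orthogonal.
  have hlarge : ∀ a ∈ Finset.Ioc (m - n) m, ∀ b ∈ Finset.Ioc (m - n) m,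
      ∀ u ∈ Finset.Ioc (m - n) m, eMode k m n a b (r - 1) •
        eMode k m n (i + n) (u + n) (-1) • (bData k m n).vac = 0 := by
    intro a ha b hb u hu
    rw [Finset.mem_Ioc] at ha hb hu hi
    rw [eMode_eMode_vac k m n (bOk_iff.2 (by omega)) (bOk_iff.2 (by omega)) hr1,
      kappaForm_mixed k m n (by omega) (by omega), if_neg (by omega), if_neg (by omega)]
    simp
  have hsmall : ∀ u ∈ Finset.Icc 1 (m - n), eMode k m n u q (r - 1) •
        eMode k m n i u (-1) • (bData k m n).vac
      = (if q = i then eMode k m n u u (r - 2) • (bData k m n).vac else 0)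
        - eMode k m n i q (r - 2) • (bData k m n).vac
        + (if r = 2 then (if q = i then alpha1 k n else 0) else 0) • (bData k m n).vac := by
    intro u hu
    rw [Finset.mem_Ioc] at hi hq
    rw [Finset.mem_Icc] at hu
    rw [eMode_eMode_vac k m n (bOk_iff.2 (by omega)) (bOk_iff.2 (by omega)) hr1,
      kappaForm_small k m n (by omega) (by omega) (by omega) (by omega), if_pos rfl,
      if_neg (show ¬ (u = q ∧ i = u) by omega), show r - 1 + -1 = r - 2 by ring]
    congr 2
    by_cases h : r = 2
    · subst h
      norm_num [eq_comm]
    · rw [if_neg h, if_neg (by omega)]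
  have hL : ∀ u ∈ Finset.Ioc (m - n) m, diagMode k m n p q r •
        eMode k m n u j (-1) • eMode k m n (i + n) (u + n) (-1) • (bData k m n).vac
      = (if r = 1 then
          (if p = j then (if q = u then
              alpha1 k n • eMode k m n (i + n) (u + n) (-1) • (bData k m n).vac else 0) else 0)
          + (if p = q then (if u = j then
              eMode k m n (i + n) (u + n) (-1) • (bData k m n).vac else 0) else 0)
          + (if q = i then (if p = u then
              alpha2 k m • eMode k m n u j (-1) • (bData k m n).vac else 0) else 0)
          + (if p = q then (if i = u then
              eMode k m n u j (-1) • (bData k m n).vac else 0) else 0) else 0) := by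
    intro u hu
    rw [diagMode_large k hp hq hi hj hr0 hu, hlarge p hp j hj u hu, hlarge u hu q hq u hu,
      eMode_vac k m n _ _ hr1, eMode_vac k m n _ _ hr1]
    by_cases h : r = 1
    · simp only [h, if_true, smul_zero, ite_self, sub_zero, zero_add, ite_and, add_smul, ite_smul,
        zero_smul, one_smul, eq_comm (a := p) (b := u), ← add_assoc]
      split_ifs <;> simp only [add_zero, zero_add]
    · simp only [h, if_false, smul_zero, ite_self, sub_zero, add_zero, zero_smul]
  rw [diagMode_W2vec, diagMode_lower k hp hq hi hj hr0, diagMode_diag k hp hq hi hj hr0,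
    Finset.sum_congr rfl hL,
    Finset.sum_congr rfl fun u hu => diagMode_small k hp hq hi hj hr0 hu]
  simp only [eMode_vac k m n _ _ hr1, smul_zero, ite_self, sub_zero, zero_sub, neg_smul]
  rw [sub_eq_add_neg]
  refine congrArg₂ _ (congrArg₂ _ ?_ ?_) ?_
  · rfl
  · simp only [Finset.sum_ite_irrel, Finset.sum_add_distrib, Finset.sum_const_zero,
      Finset.sum_ite_eq, Finset.sum_ite_eq', hp, hq, hi, hj, if_true]
  · by_cases h : p = j
    · simp only [if_pos h]
      rw [Finset.sum_neg_distrib, neg_neg]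
      exact Finset.sum_congr rfl hsmall
    · simp only [if_neg h, neg_zero, Finset.sum_const_zero]

/-- `α₁ = α₂ - (m - n)`: the sums over `u ≤ m - n` shift the level by their number of terms. -/
theorem alpha1_eq (hmn : n ≤ m) : alpha1 k n = alpha2 k m - ((m - n : ℕ) : ℂ) := by
  rw [alpha1, alpha2, Nat.cast_sub hmn]
  ring

/-- The terms `e_{p,j}[-1]` arising from the derivative term and from the quadratic terms cancel, and the
`m - n` terms `e_{i,q}[-1]` from `u ≤ m - n` turn the coefficient `α₂` of `e_{i,q}[-1]` into
`α₁`. -/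
theorem diagMode_one_W2vec (hmn : n ≤ m)
    (hp : p ∈ Finset.Ioc (m - n) m) (hq : q ∈ Finset.Ioc (m - n) m)
    (hi : i ∈ Finset.Ioc (m - n) m) (hj : j ∈ Finset.Ioc (m - n) m) :
    diagMode k m n p q 1 • W2vec k m n i j
      = (if p = j then alpha1 k n • W1vec k m n i q else 0)
        + (if p = q then W1vec k m n i j else 0)
        + (if p = j ∧ q = i then ∑ w : {w : ℕ // w ∈ Finset.Icc 1 (m - n)}, W1vec k m n w w
            else 0) := by
  have hsum : ∑ w : {w : ℕ // w ∈ Finset.Icc 1 (m - n)}, W1vec k m n w w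
      = ∑ w ∈ Finset.Icc 1 (m - n), eMode k m n w w (-1) • (bData k m n).vac := by
    rw [← Finset.sum_coe_sort (Finset.Icc 1 (m - n))]
    refine Finset.sum_congr rfl fun w _ => ?_
    have hw := Finset.mem_Icc.1 w.2
    rw [W1vec_eq k m n hmn (.small w), if_neg (by omega), add_zero]
  have hi' := (Finset.mem_Ioc.1 hi).1
  rw [diagMode_pos_W2vec k hp hq hi hj le_rfl, hsum, W1vec_eq k m n hmn (.large hi hq),
    W1vec_eq k m n hmn (.large hi hj), if_pos hi', if_pos hi', if_pos rfl]
  simp only [show ¬ (1 : ℤ) = 2 by norm_num, if_false, zero_smul, add_zero,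
    show (1 : ℤ) - 2 = -1 by norm_num, Finset.sum_sub_distrib, Finset.sum_const, Nat.card_Icc,
    Nat.add_sub_cancel, alpha1_eq k hmn, sub_smul, smul_add, ← Nat.cast_smul_eq_nsmul ℂ]
  rcases Classical.propComplete (p = j) with h1 | h1 <;>
    rcases Classical.propComplete (q = i) with h2 | h2 <;>
    rcases Classical.propComplete (p = q) with h3 | h3 <;>
    simp only [h1, h2, h3, if_true, if_false, and_self, and_true, and_false,
      Finset.sum_const_zero, smul_sub, smul_zero, neg_smul] <;> abel

/-- The derivative term gives `-2α₂α₁` and the terms `u ≤ m - n` give `(m - n)α₁`, which together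
make `-(α₁ + α₂)α₁`. -/
theorem diagMode_two_W2vec (hmn : n ≤ m)
    (hp : p ∈ Finset.Ioc (m - n) m) (hq : q ∈ Finset.Ioc (m - n) m)
    (hi : i ∈ Finset.Ioc (m - n) m) (hj : j ∈ Finset.Ioc (m - n) m) :
    diagMode k m n p q 2 • W2vec k m n i j
      = -((if q = i ∧ p = j then (alpha1 k n + alpha2 k m) * alpha1 k n else 0)
        + (if p = q ∧ i = j then 2 * alpha2 k m else 0)) • (bData k m n).vac := by
  rw [diagMode_pos_W2vec k hp hq hi hj (by norm_num)]
  simp only [sub_self, eMode_vac k m n _ _ le_rfl, ite_self, if_true, zero_add,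
    show ¬ (2 : ℤ) = 1 by norm_num, if_false, add_zero, Finset.sum_const, Nat.card_Icc,
    Nat.add_sub_cancel, ← Nat.cast_smul_eq_nsmul ℂ, alpha1_eq k hmn]
  rcases Classical.propComplete (p = j) with h1 | h1 <;>
    rcases Classical.propComplete (q = i) with h2 | h2 <;>
    rcases Classical.propComplete (p = q ∧ i = j) with h3 | h3 <;>
    simp only [h1, h2, h3, if_true, if_false, and_self, and_true, and_false] <;> module

theorem diagMode_ge_three_W2vec
    (hp : p ∈ Finset.Ioc (m - n) m) (hq : q ∈ Finset.Ioc (m - n) m)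
    (hi : i ∈ Finset.Ioc (m - n) m) (hj : j ∈ Finset.Ioc (m - n) m) {r : ℤ} (hr : 3 ≤ r) :
    diagMode k m n p q r • W2vec k m n i j = 0 := by
  rw [diagMode_pos_W2vec k hp hq hi hj (by omega), if_neg (show r ≠ 1 by omega)]
  have h2 : r ≠ 2 := by omega
  simp [eMode_vac k m n _ _ (show 0 ≤ r - 2 by omega), h2]

end W1W2

/-! ### The commutator in `𝒰(𝒲)` -/

section Final

variable (k : ℂ) {m n : ℕ}

theorem cast_choose_two_int (s : ℤ) :
    ((Ring.choose s 2 : ℤ) : ℂ) = (s : ℂ) * ((s : ℂ) - 1) / 2 := by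
  have h := Ring.descPochhammer_eq_factorial_smul_choose s 2
  rw [descPochhammer_succ_right, Polynomial.smeval_mul] at h
  simp only [descPochhammer_one, Polynomial.smeval_sub, Polynomial.smeval_X, pow_one,
    Nat.cast_one, Polynomial.smeval_one, pow_zero, one_smul, Nat.factorial_two, nsmul_eq_mul,
    Nat.cast_ofNat] at h
  have h' := congrArg (Int.cast : ℤ → ℂ) h
  push_cast at h'
  rw [h']
  ring

theorem nProd_vac (r : ℤ) (v : VB k m n) :
    NProd k m n (bData k m n).vac r v (if r = -1 then v else 0) :=
  ⟨_, IsStateField.vac, rfl⟩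

/-- The vacuum acts in `𝒰(𝒲)` through `|0⟩ t^a = δ_{a,-1}`; the scalar terms of the commutator
arise from it. -/
theorem wMode_WVac (a : ℤ) :
    wMode (WVac k m n) a = if a = -1 then 1 else 0 :=
  envMode_vac _ _ _ (nProd_vac k (-2) _) a

/-- The products `(W^{(1)}_{p,q})_{(r)} W^{(2)}_{i,j}`, `r ≥ 0`, as homogeneous elements of the
`W`-algebra. -/
noncomputable def W1ProdW2 (hmn : n ≤ m) {i j p q : ℕ}
    (hi : i ∈ Finset.Ioc (m - n) m) (hj : j ∈ Finset.Ioc (m - n) m)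
    (hp : p ∈ Finset.Ioc (m - n) m) (hq : q ∈ Finset.Ioc (m - n) m) :
    (r : ℕ) → WGr k m n (1 + 2 - r - 1)
  | 0 => - (if p = j then W2 k hmn i q (.large hi hq) else 0)
      + (if i = q then W2 k hmn p j (.large hp hj) else 0)
  | 1 => (if p = j then alpha1 k n • W1 k hmn i q (.large hi hq) else 0)
      + (if p = q then W1 k hmn i j (.large hi hj) else 0)
      + (if p = j ∧ q = i then
          ∑ w : {w : ℕ // w ∈ Finset.Icc 1 (m - n)}, W1 k hmn w w (.small w) else 0)
  | 2 => -((if q = i ∧ p = j then (alpha1 k n + alpha2 k m) * alpha1 k n else 0)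
      + (if p = q ∧ i = j then 2 * alpha2 k m else 0)) • WVac k m n
  | _ + 3 => 0

theorem nProd_W1ProdW2 (hmn : n ≤ m) {i j p q : ℕ}
    (hi : i ∈ Finset.Ioc (m - n) m) (hj : j ∈ Finset.Ioc (m - n) m)
    (hp : p ∈ Finset.Ioc (m - n) m) (hq : q ∈ Finset.Ioc (m - n) m) (r : ℕ) :
    NProd k m n (W1 k hmn p q (.large hp hq)) r (W2 k hmn i j (.large hi hj))
      (W1ProdW2 k hmn hi hj hp hq r) := by
  have h := nProd_W1vec k m n hmn hp hq r (W2vec k m n i j)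
  rw [← add_smul, ← diagMode] at h
  suffices hr : (W1ProdW2 k hmn hi hj hp hq r : VB k m n)
      = diagMode k m n p q r • W2vec k m n i j by rw [hr]; exact h
  match r with
  | 0 =>
    refine Eq.trans ?_ (diagMode_zero_W2vec k hp hq hi hj).symm
    change (WGr k m n 2).subtype (- (if p = j then W2 k hmn i q (.large hi hq) else 0)
      + (if i = q then W2 k hmn p j (.large hp hj) else 0)) = _
    rw [map_add, map_neg]
    split_ifs <;> try rw [map_zero]
    all_goals rfl
  | 1 =>
    refine Eq.trans ?_ (diagMode_one_W2vec k hmn hp hq hi hj).symm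
    change (WGr k m n 1).subtype ((if p = j then alpha1 k n • W1 k hmn i q (.large hi hq) else 0)
      + (if p = q then W1 k hmn i j (.large hi hj) else 0)
      + (if p = j ∧ q = i then
          ∑ w : {w : ℕ // w ∈ Finset.Icc 1 (m - n)}, W1 k hmn w w (.small w) else 0)) = _
    rw [map_add, map_add]
    split_ifs <;> simp only [map_zero, map_smul, map_sum] <;> rfl
  | 2 => exact (diagMode_two_W2vec k hmn hp hq hi hj).symm
  | r + 3 =>
    exact (diagMode_ge_three_W2vec k hp hq hi hj (r := (r + 3 : ℕ)) (by push_cast; omega)).symm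

end Final

theorem mainTheorem6 (k : ℂ) (m n : ℕ) (hmn : n ≤ m) (i j p q : ℕ)
    (hi : i ∈ Finset.Ioc (m - n) m) (hj : j ∈ Finset.Ioc (m - n) m)
    (hp : p ∈ Finset.Ioc (m - n) m) (hq : q ∈ Finset.Ioc (m - n) m) (s u : ℤ) :
    wMode (W1 k hmn p q (.large hp hq)) s * wMode (W2 k hmn i j (.large hi hj)) u
        - wMode (W2 k hmn i j (.large hi hj)) u * wMode (W1 k hmn p q (.large hp hq)) s
      = - (if p = j then wMode (W2 k hmn i q (.large hi hq)) (s + u) else 0)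
        + (if i = q then wMode (W2 k hmn p j (.large hp hj)) (s + u) else 0)
        + (if p = j then
            ((s : ℂ) * alpha1 k n) • wMode (W1 k hmn i q (.large hi hq)) (s + u - 1) else 0)
        + (if p = q then
            (s : ℂ) • wMode (W1 k hmn i j (.large hi hj)) (s + u - 1) else 0)
        + (if p = j ∧ q = i then
            (s : ℂ) • ∑ w : {w : ℕ // w ∈ Finset.Icc 1 (m - n)},
              wMode (W1 k hmn w w (.small w)) (s + u - 1) else 0)
        - (if q = i ∧ p = j ∧ s + u = 1 then
            algebraMap ℂ (UW k m n)
              ((s : ℂ) * ((s : ℂ) - 1) / 2 * (alpha1 k n + alpha2 k m) * alpha1 k n) else 0)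
        - (if p = q ∧ i = j ∧ s + u = 1 then
            algebraMap ℂ (UW k m n) ((s : ℂ) * ((s : ℂ) - 1) * alpha2 k m) else 0) := by
  have hcomm := envMode_comm (WGr k m n) (NProd k m n) (WVac k m n)
    (W1 k hmn p q (.large hp hq)) (W2 k hmn i j (.large hi hj)) s u
    (W1ProdW2 k hmn hi hj hp hq) 3 (nProd_W1ProdW2 k hmn hi hj hp hq)
    (fun r hr => by
      obtain ⟨r, rfl⟩ := Nat.exists_eq_add_of_le' hr
      rfl)
  refine hcomm.trans ?_
  rw [Finset.sum_range_succ, Finset.sum_range_succ, Finset.sum_range_one]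
  have h0 : envMode (WGr k m n) (NProd k m n) (WVac k m n) (W1ProdW2 k hmn hi hj hp hq 0)
        (s + u - (0 : ℕ))
      = - (if p = j then wMode (W2 k hmn i q (.large hi hq)) (s + u) else 0)
        + (if i = q then wMode (W2 k hmn p j (.large hp hj)) (s + u) else 0) := by
    refine (congrArg (envMode _ _ _ (W1ProdW2 k hmn hi hj hp hq 0))
      (by simp : s + u - ((0 : ℕ) : ℤ) = s + u)).trans ?_
    change envModeLin (WGr k m n) (NProd k m n) (WVac k m n) 2 (s + u)
      (- (if p = j then W2 k hmn i q (.large hi hq) else 0)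
        + (if i = q then W2 k hmn p j (.large hp hj) else 0)) = _
    rw [map_add, map_neg]
    split_ifs <;> try rw [map_zero]
    all_goals rfl
  have h1 : envMode (WGr k m n) (NProd k m n) (WVac k m n) (W1ProdW2 k hmn hi hj hp hq 1)
        (s + u - (1 : ℕ))
      = (if p = j then alpha1 k n • wMode (W1 k hmn i q (.large hi hq)) (s + u - 1) else 0)
        + (if p = q then wMode (W1 k hmn i j (.large hi hj)) (s + u - 1) else 0)
        + (if p = j ∧ q = i then
            ∑ w : {w : ℕ // w ∈ Finset.Icc 1 (m - n)},
              wMode (W1 k hmn w w (.small w)) (s + u - 1) else 0) := by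
    change envModeLin (WGr k m n) (NProd k m n) (WVac k m n) 1 (s + u - 1)
      ((if p = j then alpha1 k n • W1 k hmn i q (.large hi hq) else 0)
      + (if p = q then W1 k hmn i j (.large hi hj) else 0)
      + (if p = j ∧ q = i then
          ∑ w : {w : ℕ // w ∈ Finset.Icc 1 (m - n)}, W1 k hmn w w (.small w) else 0)) = _
    rw [map_add, map_add]
    split_ifs <;> simp only [map_zero, map_smul, map_sum] <;> rfl
  have h2 : envMode (WGr k m n) (NProd k m n) (WVac k m n) (W1ProdW2 k hmn hi hj hp hq 2)
        (s + u - (2 : ℕ))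
      = -((if q = i ∧ p = j then (alpha1 k n + alpha2 k m) * alpha1 k n else 0)
        + (if p = q ∧ i = j then 2 * alpha2 k m else 0)) •
          (if s + u = 1 then 1 else 0 : UW k m n) := by
    change envModeLin (WGr k m n) (NProd k m n) (WVac k m n) 0 (s + u - 2) (_ • WVac k m n) = _
    rw [map_smul]
    refine congrArg _ ((wMode_WVac k _).trans ?_)
    simp only [show s + u - 2 = -1 ↔ s + u = 1 by omega]
  rw [h0, h1, h2, cast_choose_two_int, Ring.choose_zero_right, Ring.choose_one_right]
  simp only [Algebra.algebraMap_eq_smul_one]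
  -- Both sides are now linear in the same elements, once each Kronecker delta is evaluated.
  rcases Classical.propComplete (p = j) with c1 | c1 <;>
    rcases Classical.propComplete (q = i) with c2 | c2 <;>
    rcases Classical.propComplete (p = q) with c3 | c3 <;>
    rcases Classical.propComplete (i = j) with c4 | c4 <;>
    rcases Classical.propComplete (s + u = 1) with c5 | c5 <;>
    simp only [c1, c2, c3, c4, c5, if_true, if_false, and_self, and_true, and_false] <;> module
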